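/- Let $d$ be an odd positive integer, $\ell=\sqrt{2\pi/d}$, $\omega=e^{2\pi i/d}$. For $x,p\in\mathbb R$ let $D(x,p)=e^{ixp/2}e^{-ix\hat p}e^{ip\hat x}=e^{i(p\hat x-x\hat p)}$, i.e. $(D(x,p)g)(y)=e^{-ixp/2}e^{ipy}g(y-x)$; it acts on Schwartz functions and, by $\langle f|D(x,p)\psi\rangle=\langle D(-x,-p)f|\psi\rangle$, on generalised kets (continuous antilinear functionals $\psi: f\mapsto\langle f|\psi\rangle$ on $\mathcal S(\mathbb R)$). The Heisenberg--Weyl group $H_3$ of elements $g(\varphi,x,p)$ is represented by $\pi(g(\varphi,x,p))=e^{i\varphi}D(x,p)$, and the isotropy group of a ket $\psi$ consists of the $g$ with $\pi(g)\psi=c\psi$, $|c|=1$. The GKP code space $\mathcal C$ is the span of the kets $|\bar j\rangle=\ell^{-1/2}\sum_{n\in\mathbb Z}|j\ell+d\ell n\rangle$ ($0\le j<d$), where $\langle f|x\rangle=\overline{f(x)}$; it carries the inner product for which the $|\bar j\rangle$ are orthonormal, and $\langle\psi|\chi\rangle$ below is this inner product if $\psi,\chi\in\mathcal C$. Let $\bar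 D_d(a,b)=\omega^{\frac{d+1}2ab}D(a\ell,0)D(0,b\ell)$ be the encoded displacements. Operator identities are understood through matrix elements between Schwartz functions. On the torus $\mathbb T^2=[0,d\ell)^2$ with $d\mu=\frac1d\,du\,dv$ put $Y_{mn}(u,v)=\frac1{\sqrt{2\pi}}e^{i\ell(nv-mu)}$, $m,n\in\mathbb Z$. For a reference ket $\psi_0\in\mathcal C$ (not necessarily normalised) and $\Omega=(u,v)$ let $|\Omega\rangle=D(u,v)\psi_0$. Put $\langle\Omega|\Omega'\rangle=\langle\psi_0|D(\Omega)^\dagger D(\Omega')\psi_0\rangle$ if $D(\Omega)^\dagger D(\Omega')\psi_0\in\mathcal C$ and $\langle\Omega|\Omega'\rangle=0$ otherwise; this vanishes for all but finitely many $\Omega'\in\mathbb T^2$, and $|\langle\Omega|\Omega'\rangle|^2$ is read as the Dirac comb in $\Omega'$ (with respect to $du'\,dv'$) having mass $|\langle\Omega|\Omega'\rangle|^2$ at each of these points. The generalised Brif--Mann construction with phase function $\varphi$ consists of real coefficients $\tau_{mn}$, operators $D_{mn}$ and a kernel $\Delta$ given by $$|\langle\Omega|\Omega'\rangle|^2=\sum_{m,n}\tau_{mn}\overline{Y_{mn}(\Omega)}Y_{mn}(\Omega'),\qquad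 e^{i\varphi_{mn}}\tau_{mn}^{1/2}D_{mn}=\int_{\mathbb T^2}d\mu(\Omega)\,Y_{mn}(\Omega)|\Omega\rangle\langle\Omega|,\qquad \Delta(\Omega)=\sum_{m,n}Y_{mn}(\Omega)D_{mn}^\dagger,$$ where the first equation is an identity of distributions in $\Omega'$ on the torus (tested against each $\overline{Y_{m'n'}}$). Let $$\Delta^{\mathcal C}(u,v)=D(u,v)\Delta^{\mathcal C}(0,0)D(u,v)^\dagger,\qquad \Delta^{\mathcal C}(0,0)=\frac1{2\pi}\sum_{m,n\in\mathbb Z}(-1)^{mn}D(n\ell,m\ell)$$ be the Zak--Gross kernel. Then: 1. $\mu$ is invariant under translations of the torus; the $Y_{mn}$ are eigenfunctions of its Laplacian and an orthonormal basis of $L^2(\mathbb T^2,\mu)$; the matrix elements of the series for $\Delta^{\mathcal C}(0,0)$ converge absolutely. 2. Let $\psi_0\in\mathcal C$ have isotropy group $\{g(\varphi,x,p):x,p\in d\ell\,\mathbb Z\}$ (that is, $U(1)\times\mathbb Z\times\mathbb Z$). Then $(u,v)\mapsto g(0,u,v)$ induces a bijection of $\mathbb T^2$ onto the quotient of $H_3$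 by this isotropy group, and there is exactly one family $\tau$ as above. 3. Assume moreover that $\tau_{mn}\neq0$ for all $m,n$. Then $\tau_{mn}=|\langle\psi_0|D(n\ell,m\ell)\psi_0\rangle|^2>0$, the integrals defining $D_{mn}$ converge, and for the phase choice $\varphi_{mn}=\arg\langle\psi_0|\bar D_d(n,m)\psi_0\rangle$ one has $D_{mn}^\dagger=\frac1{\sqrt{2\pi}}(-1)^{mn}D(n\ell,m\ell)$, the series for $\Delta$ converges absolutely, and $\Delta(u,v)=\Delta^{\mathcal C}(u,v)$ for all $(u,v)\in\mathbb T^2$. For $\varphi_{mn}=\arg\langle\psi_0|D(n\ell,m\ell)\psi_0\rangle$ one gets instead $\Delta(u,v)=\frac1{2\pi}\sum_{m,n}e^{i\ell(nv-mu)}D(n\ell,m\ell)$. 4. Consequently $\Delta$, with $\varphi_{mn}=\arg\langle\psi_0|\bar D_d(n,m)\psi_0\rangle$, is the same for any two reference kets satisfying the hypotheses of 2 and 3. -/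

import Mathlib

open scoped SchwartzMap ComplexConjugate

namespace ZakGross

noncomputable section

/-! ### Displacement operators on Schwartz functions and on generalised kets -/

theorem hasTemperateGrowth_cexp (p : ℝ) :
    (fun y : ℝ => Complex.exp (Complex.I * p * y)).HasTemperateGrowth := by
  have hder : ∀ n : ℕ, iteratedDeriv n (fun y : ℝ => Complex.exp (Complex.I * p * y))
      = fun y : ℝ => (Complex.I * p) ^ n * Complex.exp (Complex.I * p * y) := by
    intro n
    induction n with
    | zero => simp
    | succ n ih =>
      rw [iteratedDeriv_succ, ih]
      funext y
      have h : HasDerivAt (fun y : ℝ => Complex.exp (Complex.I * p * y))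
          (Complex.exp (Complex.I * p * y) * (Complex.I * p * 1)) y :=
        ((Complex.ofRealCLM.hasDerivAt (x := y)).const_mul (Complex.I * p)).cexp
      rw [(h.const_mul _).deriv]
      ring
  refine ⟨(contDiff_const.mul Complex.ofRealCLM.contDiff).cexp, fun n => ⟨0, |p| ^ n, fun x => ?_⟩⟩
  rw [norm_iteratedFDeriv_eq_norm_iteratedDeriv, hder n]
  have h1 : ‖Complex.exp (Complex.I * p * x)‖ = 1 := by
    have := Complex.norm_exp_ofReal_mul_I (p * x)
    rw [← this]
    congr 2
    push_cast
    ring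
  simp [norm_pow, h1]

/-- `exp (i p x̂)`: multiplication by `y ↦ exp (i p y)`. -/
def modulation (p : ℝ) : 𝓢(ℝ, ℂ) →L[ℂ] 𝓢(ℝ, ℂ) :=
  SchwartzMap.smulLeftCLM ℂ (fun y : ℝ => Complex.exp (Complex.I * p * y))

/-- `exp (-i x p̂)`: the translation `g ↦ g (· - x)`. -/
def translation (x : ℝ) : 𝓢(ℝ, ℂ) →L[ℂ] 𝓢(ℝ, ℂ) :=
  SchwartzMap.compSubConstCLM ℂ x

/-- The displacement operator `D(x,p) = exp (i x p / 2) exp (-i x p̂) exp (i p x̂)`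
`= exp (i (p x̂ - x p̂))`. -/
def displacement (x p : ℝ) : 𝓢(ℝ, ℂ) →L[ℂ] 𝓢(ℝ, ℂ) :=
  Complex.exp (Complex.I * x * p / 2) • (translation x ∘L modulation p)

theorem displacement_apply (x p : ℝ) (g : 𝓢(ℝ, ℂ)) (y : ℝ) :
    displacement x p g y
      = Complex.exp (-(Complex.I * x * p / 2)) * Complex.exp (Complex.I * p * y) * g (y - x) := by
  simp only [displacement, translation, modulation, smul_apply,
    ContinuousLinearMap.comp_apply, SchwartzMap.compSubConstCLM_apply,
    SchwartzMap.smulLeftCLM_apply_apply (hasTemperateGrowth_cexp p), smul_eq_mul]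
  rw [← mul_assoc, ← Complex.exp_add, ← Complex.exp_add]
  congr 2
  push_cast
  ring

theorem displacement_displacement (x p x' p' : ℝ) (g : 𝓢(ℝ, ℂ)) :
    displacement x p (displacement x' p' g)
      = Complex.exp (Complex.I * ((p * x' - x * p') / 2 : ℝ)) •
        displacement (x + x') (p + p') g := by
  ext y
  simp only [displacement_apply, smul_apply, smul_eq_mul]
  have hy : y - x - x' = y - (x + x') := by ring
  rw [hy]
  simp only [← mul_assoc, ← Complex.exp_add]
  congr 2
  push_cast
  ring

theorem displacement_zero (g : 𝓢(ℝ, ℂ)) : displacement 0 0 g = g := by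
  ext y
  simp [displacement_apply]

/-- The inner product `⟨f|g⟩` of two Schwartz functions, antilinear in `f`. -/
def braket (f g : 𝓢(ℝ, ℂ)) : ℂ := ∫ y : ℝ, conj (f y) * g y

/-- `D(x,p)† = D(-x,-p)`. -/
theorem braket_displacement (x p : ℝ) (f g : 𝓢(ℝ, ℂ)) :
    braket f (displacement x p g) = braket (displacement (-x) (-p) f) g := by
  unfold braket
  rw [← MeasureTheory.integral_add_right_eq_self
    (fun y : ℝ => conj (f y) * displacement x p g y) x]
  congr 1
  funext y
  simp only [displacement_apply, map_mul, ← Complex.exp_conj, add_sub_cancel_right, sub_neg_eq_add]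
  simp only [map_neg, map_mul, map_div₀, Complex.conj_I, Complex.conj_ofReal, map_ofNat]
  rw [mul_comm (conj (f (y + x))), mul_right_comm, ← Complex.exp_add, ← Complex.exp_add]
  congr 3
  push_cast
  ring

/-- Generalised kets: the continuous antilinear functionals on Schwartz space (tempered
distributions, acting as `f ↦ ⟨f|ψ⟩`), i.e. the large space of the Gelfand triple
`𝓢(ℝ) ⊂ L²(ℝ) ⊂ 𝓢(ℝ)ˣ`. -/
abbrev Ket := 𝓢(ℝ, ℂ) →L⋆[ℂ] ℂ

/-- The action of `D(x,p)` on kets: `⟨f|D(x,p) ψ⟩ = ⟨D(x,p)† f|ψ⟩` with `D(x,p)† = D(-x,-p)`. -/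
def dispKet (x p : ℝ) (ψ : Ket) : Ket := ψ.comp (displacement (-x) (-p))

theorem dispKet_apply (x p : ℝ) (ψ : Ket) (f : 𝓢(ℝ, ℂ)) :
    dispKet x p ψ f = ψ (displacement (-x) (-p) f) := rfl

theorem dispKet_smul (x p : ℝ) (c : ℂ) (ψ : Ket) :
    dispKet x p (c • ψ) = c • dispKet x p ψ := rfl

theorem dispKet_dispKet (x p x' p' : ℝ) (ψ : Ket) :
    dispKet x p (dispKet x' p' ψ)
      = Complex.exp (Complex.I * ((p * x' - x * p') / 2 : ℝ)) • dispKet (x + x') (p + p') ψ := by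
  ext f
  simp only [dispKet_apply, smul_apply, displacement_displacement,
    ContinuousLinearMap.map_smulₛₗ, ← Complex.exp_conj, map_mul, Complex.conj_I,
    Complex.conj_ofReal, smul_eq_mul]
  rw [show -x' + -x = -(x + x') by ring, show -p' + -p = -(p + p') by ring]
  congr 2
  push_cast
  ring

/-! ### The Heisenberg--Weyl group and isotropy subgroups -/

/-- The (simply connected) Heisenberg--Weyl group, with elements `g(φ,x,p)`. -/
@[ext]
structure Heis where
  phase : ℝ
  x : ℝ
  p : ℝ

instance : Mul Heis :=
  ⟨fun g h => ⟨g.phase + h.phase + (g.p * h.x - g.x * h.p) / 2, g.x + h.x, g.p + h.p⟩⟩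

instance : One Heis := ⟨⟨0, 0, 0⟩⟩

instance : Inv Heis := ⟨fun g => ⟨-g.phase, -g.x, -g.p⟩⟩

theorem Heis.mul_def (g h : Heis) :
    g * h = ⟨g.phase + h.phase + (g.p * h.x - g.x * h.p) / 2, g.x + h.x, g.p + h.p⟩ := rfl

theorem Heis.one_def : (1 : Heis) = ⟨0, 0, 0⟩ := rfl

theorem Heis.inv_def (g : Heis) : g⁻¹ = ⟨-g.phase, -g.x, -g.p⟩ := rfl

instance : Group Heis :=
  Group.ofLeftAxioms
    (by intro a b c; simp only [Heis.mul_def, Heis.mk.injEq]; refine ⟨?_, ?_, ?_⟩ <;> ring)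
    (by intro a; simp [Heis.mul_def, Heis.one_def])
    (by
      intro a
      simp only [Heis.mul_def, Heis.one_def, Heis.inv_def, Heis.mk.injEq]
      refine ⟨?_, ?_, ?_⟩ <;> ring)

/-- The unitary representation `π(g(φ,x,p)) = exp (i φ) D(x,p)`, acting on kets. -/
def rep (g : Heis) (ψ : Ket) : Ket := Complex.exp (Complex.I * g.phase) • dispKet g.x g.p ψ

theorem rep_mul (g h : Heis) (ψ : Ket) : rep (g * h) ψ = rep g (rep h ψ) := by
  simp only [rep, Heis.mul_def, dispKet_smul, dispKet_dispKet, smul_smul, ← Complex.exp_add]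
  congr 2
  push_cast
  ring

theorem rep_one (ψ : Ket) : rep 1 ψ = ψ := by
  ext f
  simp [rep, Heis.one_def, dispKet_apply, displacement_zero]

theorem rep_smul (g : Heis) (c : ℂ) (ψ : Ket) : rep g (c • ψ) = c • rep g ψ := by
  simp only [rep, dispKet_smul, smul_smul, mul_comm]

/-- The isotropy subgroup of `ψ`: the elements that fix `ψ` up to a phase. -/
def isotropy (ψ : Ket) : Subgroup Heis where
  carrier := {g | ∃ c : ℂ, ‖c‖ = 1 ∧ rep g ψ = c • ψ}
  mul_mem' := by
    rintro g h ⟨c, hc, hg⟩ ⟨c', hc', hh⟩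
    exact ⟨c' * c, by simp [hc, hc'], by rw [rep_mul, hh, rep_smul, hg, smul_smul]⟩
  one_mem' := ⟨1, by simp, by simp [rep_one]⟩
  inv_mem' := by
    rintro g ⟨c, hc, hg⟩
    have hc0 : c ≠ 0 := by
      rintro rfl
      simp at hc
    refine ⟨c⁻¹, by simp [hc], ?_⟩
    have h : rep g⁻¹ (rep g ψ) = ψ := by rw [← rep_mul, inv_mul_cancel, rep_one]
    rw [hg, rep_smul] at h
    rw [← h, smul_smul, inv_mul_cancel₀ hc0, one_smul, h]

/-! ### The GKP code -/

/-- The logical step `ℓ = √(2π/d)`. -/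
def step (d : ℕ) : ℝ := √(2 * Real.pi / d)

/-- The symmetry group `U(1) × ℤ × ℤ` of the code: the elements `g(φ,x,p)` with
`x, p ∈ dℓ ℤ`, which represent the stabilizers up to a global phase. -/
def gkpSymmetry (d : ℕ) : Subgroup Heis where
  carrier := {g | ∃ k l : ℤ, g.x = k * (d * step d) ∧ g.p = l * (d * step d)}
  mul_mem' := by
    rintro g h ⟨k, l, hx, hp⟩ ⟨k', l', hx', hp'⟩
    refine ⟨k + k', l + l', ?_, ?_⟩
    · simp only [Heis.mul_def, hx, hx']; push_cast; ring
    · simp only [Heis.mul_def, hp, hp']; push_cast; ring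
  one_mem' := ⟨0, 0, by simp [Heis.one_def], by simp [Heis.one_def]⟩
  inv_mem' := by
    rintro g ⟨k, l, hx, hp⟩
    refine ⟨-k, -l, ?_, ?_⟩
    · simp only [Heis.inv_def, hx]; push_cast; ring
    · simp only [Heis.inv_def, hp]; push_cast; ring

theorem summable_inv_comb (a b : ℝ) (hb : b ≠ 0) :
    Summable (fun n : ℤ => ((1 + |a + b * n|) ^ 2)⁻¹) := by
  have h0 : Summable (fun n : ℤ => (b ^ 2)⁻¹ * (1 / |(n : ℝ) + a / b| ^ (2 : ℝ))) :=
    ((Real.summable_one_div_int_add_rpow (a / b) 2).mpr (by norm_num)).mul_left _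
  refine h0.of_norm_bounded_eventually ?_
  have hfin : {n : ℤ | (n : ℝ) + a / b = 0}.Finite := by
    apply Set.Subsingleton.finite
    intro n hn m hm
    simp only [Set.mem_ofPred_eq] at hn hm
    have : (n : ℝ) = m := by linarith
    exact_mod_cast this
  filter_upwards [hfin.compl_mem_cofinite] with n hn
  have hn' : (n : ℝ) + a / b ≠ 0 := hn
  have hab : a + b * n = b * (n + a / b) := by field_simp; ring
  have hpos : 0 < |b * ((n : ℝ) + a / b)| := abs_pos.mpr (mul_ne_zero hb hn')
  rw [Real.norm_of_nonneg (by positivity), hab, Real.rpow_two, sq_abs, one_div, ← mul_inv,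
    ← mul_pow, ← sq_abs (b * _)]
  exact inv_anti₀ (by positivity) (by gcongr; linarith)

theorem norm_le_comb (f : 𝓢(ℝ, ℂ)) (x : ℝ) :
    ‖f x‖ ≤ (4 * (Finset.Iic (2, 0)).sup (schwartzSeminormFamily ℂ ℝ ℂ) f)
      * ((1 + |x|) ^ 2)⁻¹ := by
  have h := SchwartzMap.one_add_le_sup_seminorm_apply (𝕜 := ℂ) (m := (2, 0)) (k := 2) (n := 0)
    le_rfl le_rfl f x
  simp only [norm_iteratedFDeriv_zero, Real.norm_eq_abs] at h
  rw [← div_eq_mul_inv, le_div_iff₀ (by positivity), mul_comm]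
  refine h.trans (le_of_eq ?_)
  norm_num
  rfl

theorem summable_comb (a b : ℝ) (hb : b ≠ 0) (f : 𝓢(ℝ, ℂ)) :
    Summable (fun n : ℤ => conj (f (a + b * n))) := by
  refine ((summable_inv_comb a b hb).mul_left
    (4 * (Finset.Iic (2, 0)).sup (schwartzSeminormFamily ℂ ℝ ℂ) f)).of_norm_bounded ?_
  intro n
  rw [RCLike.norm_conj]
  exact norm_le_comb f _

/-- The Dirac comb `∑ₙ |a + b n⟩` of position kets (for `b ≠ 0`), where `⟨f|x⟩ = conj (f x)`. -/
def comb (a b : ℝ) (hb : b ≠ 0) : Ket :=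
  SchwartzMap.mkCLMtoNormedSpace (fun f => ∑' n : ℤ, conj (f (a + b * n)))
    (by
      intro f g
      simp only [add_apply, map_add]
      exact (summable_comb a b hb f).tsum_add (summable_comb a b hb g))
    (by
      intro c f
      simp only [smul_apply, smul_eq_mul, map_mul]
      exact tsum_mul_left)
    ⟨Finset.Iic (2, 0), 4 * ∑' n : ℤ, ((1 + |a + b * n|) ^ 2)⁻¹, by positivity, by
      intro f
      have h := tsum_of_norm_bounded ((summable_inv_comb a b hb).hasSum.mul_left
        (4 * (Finset.Iic (2, 0)).sup (schwartzSeminormFamily ℂ ℝ ℂ) f))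
        (f := fun n : ℤ => conj (f (a + b * n)))
        (fun n => by rw [RCLike.norm_conj]; exact norm_le_comb f _)
      refine h.trans (le_of_eq (by ring))⟩

theorem comb_apply (a b : ℝ) (hb : b ≠ 0) (f : 𝓢(ℝ, ℂ)) :
    comb a b hb f = ∑' n : ℤ, conj (f (a + b * n)) := rfl

theorem period_ne_zero {d : ℕ} (j : Fin d) : (d : ℝ) * step d ≠ 0 := by
  have hd : (0 : ℝ) < d := by exact_mod_cast j.pos
  have : 0 < step d := Real.sqrt_pos.mpr (by positivity)
  positivity

/-- The encoded basis ket `ℓ^(-1/2) ∑ₙ |jℓ + dℓn⟩`. -/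
def codeword (d : ℕ) (j : Fin d) : Ket :=
  ((√(step d))⁻¹ : ℂ) • comb (j * step d) (d * step d) (period_ne_zero j)

/-- The code space, spanned by the encoded basis kets. -/
def codeSpace (d : ℕ) : Submodule ℂ Ket := Submodule.span ℂ (Set.range (codeword d))

/-- The encoding `c ↦ ∑ⱼ cⱼ |j̄⟩`. -/
def encode (d : ℕ) : (Fin d → ℂ) →ₗ[ℂ] Ket := Fintype.linearCombination ℂ (codeword d)

/-- The amplitudes of an element of the code space in the encoded basis (arbitrary outside of the
code space). -/
def amplitudes (d : ℕ) (ψ : Ket) : Fin d → ℂ := Function.invFun (encode d) ψ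

/-- The inner product of the code space, for which the encoded basis is orthonormal. -/
def codeInner (d : ℕ) (ψ χ : Ket) : ℂ := ∑ j, conj (amplitudes d ψ j) * amplitudes d χ j

/-- The encoded discrete displacement `ω^(2⁻¹ a b) X^a Z^b`, where `ω = exp (2πi/d)`,
`2⁻¹ = (d+1)/2`, `X^a = D(aℓ,0)` and `Z^b = D(0,bℓ)`. -/
def logicalDisp (d : ℕ) (a b : ℤ) (ψ : Ket) : Ket :=
  Complex.exp (2 * Real.pi * Complex.I / d) ^ (((d + 1) / 2 : ℕ) * a * b : ℤ) •
    dispKet (a * step d) 0 (dispKet 0 (b * step d) ψ)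

/-! ### The toroidal phase space and its harmonic functions -/

/-- The torus `[0,dℓ) × [0,dℓ)`. -/
def torus (d : ℕ) : Set (ℝ × ℝ) := Set.Ico 0 (d * step d) ×ˢ Set.Ico 0 (d * step d)

/-- The measure `(1/d) du dv` on the torus. -/
def torusMeasure (d : ℕ) : MeasureTheory.Measure (ℝ × ℝ) :=
  ENNReal.ofReal (1 / d) • MeasureTheory.volume.restrict (torus d)

/-- The map `(u,v) ↦ g(0,u,v) H` from the torus to the phase space `G/H`, `H` being the isotropy
subgroup of `ψ`. -/
def torusToPhaseSpace (d : ℕ) (ψ : Ket) (Ω : torus d) : Heis ⧸ isotropy ψ :=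
  QuotientGroup.mk (⟨0, Ω.1.1, Ω.1.2⟩ : Heis)

/-- Invariance of the measure on the torus under the group action by translations, functions on
the torus being doubly `dℓ`-periodic functions on the plane. -/
def IsInvariantMeasure (d : ℕ) : Prop :=
  ∀ F : ℝ × ℝ → ENNReal, Measurable F →
    (∀ u v, F (u + d * step d, v) = F (u, v)) → (∀ u v, F (u, v + d * step d) = F (u, v)) →
    ∀ x p : ℝ, ∫⁻ Ω, F (Ω.1 + x, Ω.2 + p) ∂(torusMeasure d) = ∫⁻ Ω, F Ω ∂(torusMeasure d)

/-- The harmonic functions `Y_{mn}(u,v) = (2π)^(-1/2) exp (i ℓ (n v - m u))`; `ν = (m,n)`. -/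
def torusHarmonic (d : ℕ) (ν : ℤ × ℤ) (Ω : ℝ × ℝ) : ℂ :=
  ((√(2 * Real.pi))⁻¹ : ℂ) * Complex.exp (Complex.I * step d * (ν.2 * Ω.2 - ν.1 * Ω.1))

/-- The harmonic functions are doubly periodic eigenfunctions of the (flat) Laplacian of the torus
and form an orthonormal basis of the square-integrable functions on the torus. -/
structure IsHarmonicBasis (d : ℕ) : Prop where
  periodic : ∀ ν u v, torusHarmonic d ν (u + d * step d, v) = torusHarmonic d ν (u, v) ∧
    torusHarmonic d ν (u, v + d * step d) = torusHarmonic d ν (u, v)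
  eigenfunction : ∀ (ν : ℤ × ℤ) (u v : ℝ),
    deriv (fun s => deriv (fun r => torusHarmonic d ν (r, v)) s) u +
      deriv (fun s => deriv (fun r => torusHarmonic d ν (u, r)) s) v =
      -((step d : ℂ) ^ 2 * ((ν.1 : ℂ) ^ 2 + (ν.2 : ℂ) ^ 2)) * torusHarmonic d ν (u, v)
  orthonormal : ∀ ν κ : ℤ × ℤ,
    ∫ Ω, torusHarmonic d ν Ω * conj (torusHarmonic d κ Ω) ∂(torusMeasure d) = if ν = κ then 1 else 0
  complete : ∀ F : ℝ × ℝ → ℂ, MeasureTheory.MemLp F 2 (torusMeasure d) →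
    (∀ ν, ∫ Ω, F Ω * conj (torusHarmonic d ν Ω) ∂(torusMeasure d) = 0) →
    F =ᵐ[torusMeasure d] 0

/-! ### The generalised phase-space construction -/

/-- The coherent ket `|Ω⟩ = D(u,v) |ψ⟩` for `Ω = (u,v)`. -/
def coherent (ψ : Ket) (Ω : ℝ × ℝ) : Ket := dispKet Ω.1 Ω.2 ψ

open Classical in
/-- The coherent overlap `⟨Ω|Ω'⟩ = ⟨ψ| D(Ω)† D(Ω') |ψ⟩`. It is the inner product of the code space
when `D(Ω)† D(Ω') |ψ⟩` lies in the code space, and vanishes otherwise (distinct displaced code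
spaces being orthogonal). -/
def overlap (d : ℕ) (ψ : Ket) (Ω Ω' : ℝ × ℝ) : ℂ :=
  if dispKet (-Ω.1) (-Ω.2) (coherent ψ Ω') ∈ codeSpace d then
    codeInner d ψ (dispKet (-Ω.1) (-Ω.2) (coherent ψ Ω'))
  else 0

/-- The pairing `∫ dμ(Ω') |⟨Ω|Ω'⟩|² F(Ω')`. Since the codewords are Dirac combs, `|⟨Ω|Ω'⟩|²` is, as
a density in `Ω' = (u',v')` with respect to `du' dv'`, the Dirac comb with a unit Dirac mass times
the weight `|⟨Ω|Ω'⟩|²` at each of the (finitely many) points of the torus where the overlap is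
non-zero; the factor `1/d` comes from the measure. -/
def overlapPairing (d : ℕ) (ψ : Ket) (Ω : ℝ × ℝ) (F : ℝ × ℝ → ℂ) : ℂ :=
  1 / d * ∑ᶠ (Ω' : ℝ × ℝ) (_ : Ω' ∈ torus d), ((‖overlap d ψ Ω Ω'‖ ^ 2 : ℝ) : ℂ) * F Ω'

/-- The defining relation `|⟨Ω|Ω'⟩|² = ∑_ν τ_ν Y_ν*(Ω) Y_ν(Ω')` of the coefficients `τ_ν`, as an
equality of distributions in `Ω'` on the torus, i.e. tested against `Y_κ*` for every `κ`. -/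
def IsOverlapExpansion (d : ℕ) (ψ : Ket) (τ : ℤ × ℤ → ℝ) : Prop :=
  ∀ Ω ∈ torus d, ∀ κ : ℤ × ℤ,
    HasSum (fun ν : ℤ × ℤ => (τ ν : ℂ) * conj (torusHarmonic d ν Ω) *
        ∫ Ω', torusHarmonic d ν Ω' * conj (torusHarmonic d κ Ω') ∂(torusMeasure d))
      (overlapPairing d ψ Ω (fun Ω' => conj (torusHarmonic d κ Ω')))

/-- An admissible reference state `ψ` of the construction, together with its coefficients `τ`:
a ket of the code space whose isotropy group is the symmetry group of the code, and for which all
the coefficients `τ_ν` are non-zero. -/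
structure IsReference (d : ℕ) (ψ : Ket) (τ : ℤ × ℤ → ℝ) : Prop where
  mem_code : ψ ∈ codeSpace d
  isotropy_eq : isotropy ψ = gkpSymmetry d
  expansion : IsOverlapExpansion d ψ τ
  ne_zero : ∀ ν, τ ν ≠ 0

/-- The matrix element between `f` and `g` of the integrand of `∫ dμ(Ω) Y_ν(Ω) |Ω⟩⟨Ω|`. -/
def tensorIntegrand (d : ℕ) (ψ : Ket) (ν : ℤ × ℤ) (f g : 𝓢(ℝ, ℂ)) (Ω : ℝ × ℝ) : ℂ :=
  torusHarmonic d ν Ω * (coherent ψ Ω f * conj (coherent ψ Ω g))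

/-- The matrix elements `⟨f|D_ν|g⟩` of the tensor operator determined by
`exp (i φ_ν) τ_ν^(1/2) D_ν = ∫ dμ(Ω) Y_ν(Ω) |Ω⟩⟨Ω|`. -/
def tensorOp (d : ℕ) (ψ : Ket) (τ φ : ℤ × ℤ → ℝ) (ν : ℤ × ℤ) (f g : 𝓢(ℝ, ℂ)) : ℂ :=
  (Complex.exp (Complex.I * φ ν) * (√(τ ν) : ℂ))⁻¹ *
    ∫ Ω, tensorIntegrand d ψ ν f g Ω ∂(torusMeasure d)

/-- The matrix elements `⟨f|D_ν†|g⟩`. -/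
def tensorOpAdj (d : ℕ) (ψ : Ket) (τ φ : ℤ × ℤ → ℝ) (ν : ℤ × ℤ) (f g : 𝓢(ℝ, ℂ)) : ℂ :=
  conj (tensorOp d ψ τ φ ν g f)

/-- The matrix elements of the kernel `Δ(Ω) = ∑_ν Y_ν(Ω) D_ν†` produced by the construction. -/
def constructedKernel (d : ℕ) (ψ : Ket) (τ φ : ℤ × ℤ → ℝ) (Ω : ℝ × ℝ) (f g : 𝓢(ℝ, ℂ)) : ℂ :=
  ∑' ν : ℤ × ℤ, torusHarmonic d ν Ω * tensorOpAdj d ψ τ φ ν f g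

/-- The phase choice `φ_{mn} = arg ⟨ψ| D̄_d(n,m) |ψ⟩`, with the encoded displacement `D̄_d`. -/
def logicalPhase (d : ℕ) (ψ : Ket) (ν : ℤ × ℤ) : ℝ :=
  (codeInner d ψ (logicalDisp d ν.2 ν.1 ψ)).arg

/-- The phase choice `φ_{mn} = arg ⟨ψ| D(nℓ,mℓ) |ψ⟩`. -/
def displacementPhase (d : ℕ) (ψ : Ket) (ν : ℤ × ℤ) : ℝ :=
  (codeInner d ψ (dispKet (ν.2 * step d) (ν.1 * step d) ψ)).arg

/-! ### The Zak--Gross kernel -/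

/-- The term `(-1)^(mn) ⟨f|D(nℓ,mℓ)|g⟩` of the undisplaced kernel. -/
def zakGrossTerm (d : ℕ) (f g : 𝓢(ℝ, ℂ)) (ν : ℤ × ℤ) : ℂ :=
  (-1) ^ (ν.1 * ν.2) * braket f (displacement (ν.2 * step d) (ν.1 * step d) g)

/-- The matrix elements of `Δ(0,0) = (1/2π) ∑_{m,n} (-1)^(mn) D(nℓ,mℓ)`. -/
def zakGrossOrigin (d : ℕ) (f g : 𝓢(ℝ, ℂ)) : ℂ :=
  1 / (2 * Real.pi) * ∑' ν : ℤ × ℤ, zakGrossTerm d f g ν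

/-- The matrix elements of the Zak--Gross kernel `Δ(u,v) = D(u,v) Δ(0,0) D(u,v)†`. -/
def zakGrossKernel (d : ℕ) (Ω : ℝ × ℝ) (f g : 𝓢(ℝ, ℂ)) : ℂ :=
  zakGrossOrigin d (displacement (-Ω.1) (-Ω.2) f) (displacement (-Ω.1) (-Ω.2) g)

end

end ZakGross

open ZakGross

/-!
The code space consists of Dirac combs `f ↦ ℓ^(-1/2) ∑_q C_q conj (f (qℓ))` with amplitudes `C` of
period `d` (`codeKet`), on which `D(nℓ,mℓ)` acts, up to a phase, by shifting and modulating `C`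
(`dispKet_codeKet`). So `⟨ψ|D(nℓ,mℓ)ψ⟩` is, up to a phase, the ambiguity function `A(n,m)` of `C`
on `ZMod d`.

*Overlap coefficients.* The kets of the code space are fixed by `D(dℓ,0)` and `D(0,dℓ)`, hence
`D(x,p)ψ` can only be in the code space if `D(x,p)` commutes with both, that is, for
`x, p ∈ ℓ ℤ` (`exists_int_of_dispKet_mem`). The overlap density is therefore carried by the `d²`
points `Ω + ℓ(a,b)`, with weights `|A(a,b)|²`, and its Fourier coefficients are again `|A(n,m)|²`,
since `|A|²` is its own symplectic Fourier transform (`sum_ambiguity_mul_conj`). Together with the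
orthonormality of the harmonic functions this gives the existence and uniqueness of `τ`
(`isOverlapExpansion_iff`).

*Tensor operators.* In `∫ dμ(Ω) Y_ν(Ω) |Ω⟩⟨Ω|` the two combs give an absolutely convergent double
series. The integral over `v` retains the pairs of teeth at distance `nℓ`, and the integral over `u`
together with the sum over the teeth unfolds to an integral over the line. What remains is
`(2π)^(-1/2) ⟨ψ|D(nℓ,mℓ)ψ⟩ D(nℓ,mℓ)†` (`integral_tensorIntegrand`). Dividing by
`τ_ν^(1/2) exp (i φ_ν)` removes the expectation value and leaves `D(nℓ,mℓ)†`, up to the sign by which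
the encoded displacement differs from the displacement (`logicalDisp_eq`, where `d` has to be odd).
Nothing depends on the reference ket any longer.

*Convergence.* The commutation relations of `D(x,p)` with position and momentum show that matrix
elements of displacements between Schwartz functions decay faster than any power of `x` and `p`
(`exists_norm_braket_displacement_le` is the quadratic case), so the kernel converges absolutely.

*Harmonic functions.* Completeness is transported from the Fourier basis of `UnitAddTorus (Fin 2)`.
-/

namespace ZakGross

/-! ### Matrix elements of displacements between Schwartz functions -/

/-- The position operator `x̂`. -/
noncomputable def position : 𝓢(ℝ, ℂ) →L[ℂ] 𝓢(ℝ, ℂ) :=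
  SchwartzMap.smulLeftCLM ℂ (fun y : ℝ => (y : ℂ))

theorem position_apply (f : 𝓢(ℝ, ℂ)) (y : ℝ) : position f y = y * f y :=
  SchwartzMap.smulLeftCLM_apply_apply Function.Complex.hasTemperateGrowth_ofReal f y

theorem norm_displacement_apply (x p : ℝ) (g : 𝓢(ℝ, ℂ)) (y : ℝ) :
    ‖displacement x p g y‖ = ‖g (y - x)‖ := by
  rw [displacement_apply, norm_mul, norm_mul]
  have h1 : ‖Complex.exp (-(Complex.I * x * p / 2))‖ = 1 := by
    rw [← Complex.norm_exp_ofReal_mul_I (-(x * p / 2))]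
    congr 2; push_cast; ring
  have h2 : ‖Complex.exp (Complex.I * p * y)‖ = 1 := by
    rw [← Complex.norm_exp_ofReal_mul_I (p * y)]
    congr 2; push_cast; ring
  rw [h1, h2, one_mul, one_mul]

/-- The complex conjugate of a Schwartz function. -/
noncomputable def conjSchwartz (f : 𝓢(ℝ, ℂ)) : 𝓢(ℝ, ℂ) :=
  SchwartzMap.postcompCLM (𝕜 := ℝ) (Complex.conjCLE : ℂ →L[ℝ] ℂ) f

theorem conjSchwartz_apply (f : 𝓢(ℝ, ℂ)) (y : ℝ) : conjSchwartz f y = conj (f y) := rfl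

theorem integrable_conj_mul (f g : 𝓢(ℝ, ℂ)) :
    MeasureTheory.Integrable (fun y : ℝ => conj (f y) * g y) := by
  exact (SchwartzMap.pairing (ContinuousLinearMap.mul ℝ ℂ) (conjSchwartz f) g).integrable

theorem braket_add_right (f g h : 𝓢(ℝ, ℂ)) : braket f (g + h) = braket f g + braket f h := by
  simp only [braket, add_apply, mul_add]
  exact MeasureTheory.integral_add (integrable_conj_mul f g) (integrable_conj_mul f h)

theorem braket_smul_right (c : ℂ) (f g : 𝓢(ℝ, ℂ)) : braket f (c • g) = c * braket f g := by
  simp only [braket, smul_apply, smul_eq_mul, ← MeasureTheory.integral_const_mul]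
  congr 1; funext y; ring

theorem conj_braket (f g : 𝓢(ℝ, ℂ)) : conj (braket f g) = braket g f := by
  simp only [braket, ← integral_conj, map_mul, Complex.conj_conj, mul_comm]

theorem braket_position (f g : 𝓢(ℝ, ℂ)) : braket f (position g) = braket (position f) g := by
  simp only [braket, position_apply, map_mul, Complex.conj_ofReal]
  congr 1; funext y; ring

theorem braket_deriv (f g : 𝓢(ℝ, ℂ)) :
    braket f (SchwartzMap.derivCLM ℂ ℂ g) = -braket (SchwartzMap.derivCLM ℂ ℂ f) g := by
  have h := SchwartzMap.integral_mul_deriv_eq_neg_deriv_mul (conjSchwartz f) g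
  simp only [braket, SchwartzMap.derivCLM_apply]
  refine h.trans ?_
  congr 2; funext y
  congr 1
  have : (conjSchwartz f : ℝ → ℂ) = fun y => conj (f y) := funext fun y => conjSchwartz_apply f y
  rw [this]
  exact ((f.hasDerivAt y).star).deriv

/-- `x̂ D(x,p) = D(x,p) (x̂ + x)`. -/
theorem position_displacement (x p : ℝ) (g : 𝓢(ℝ, ℂ)) :
    position (displacement x p g) = displacement x p (position g) + (x : ℂ) • displacement x p g := by
  ext y
  simp only [position_apply, add_apply, smul_apply, smul_eq_mul,
    displacement_apply]
  push_cast
  ring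

/-- `p̂ D(x,p) = D(x,p) (p̂ + p)`, with `p̂ = -i d/dy`. -/
theorem deriv_displacement (x p : ℝ) (g : 𝓢(ℝ, ℂ)) :
    SchwartzMap.derivCLM ℂ ℂ (displacement x p g)
      = displacement x p (SchwartzMap.derivCLM ℂ ℂ g)
        + (Complex.I * p : ℂ) • displacement x p g := by
  ext y
  simp only [add_apply, smul_apply, smul_eq_mul,
    displacement_apply, SchwartzMap.derivCLM_apply]
  have hf : (displacement x p g : ℝ → ℂ) = fun y : ℝ => Complex.exp (-(Complex.I * x * p / 2)) *
      Complex.exp (Complex.I * p * y) * g (y - x) := funext fun y => displacement_apply x p g y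
  have h1 : HasDerivAt (fun y : ℝ => Complex.exp (Complex.I * p * y))
      (Complex.exp (Complex.I * p * y) * (Complex.I * p * 1)) y :=
    ((Complex.ofRealCLM.hasDerivAt (x := y)).const_mul (Complex.I * p)).cexp
  have h2 : HasDerivAt (fun y : ℝ => g (y - x)) (deriv g (y - x)) y :=
    HasDerivAt.comp_sub_const y x (g.hasDerivAt (y - x))
  rw [hf]
  refine ((h1.const_mul (Complex.exp (-(Complex.I * x * p / 2)))).mul h2).deriv.trans ?_
  ring

/-- The commutation relations turn multiplication of a matrix element by `x` into a combination of
matrix elements of the same kind. -/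
theorem mul_braket_displacement (x p : ℝ) (f g : 𝓢(ℝ, ℂ)) :
    x * braket f (displacement x p g) =
      braket (position f) (displacement x p g) - braket f (displacement x p (position g)) := by
  rw [← braket_position, position_displacement, braket_add_right, braket_smul_right]
  ring

/-- The same for multiplication by `p`, with derivatives in place of the position operator. -/
theorem mul_braket_displacement' (x p : ℝ) (f g : 𝓢(ℝ, ℂ)) :
    p * braket f (displacement x p g) =
      Complex.I * (braket (SchwartzMap.derivCLM ℂ ℂ f) (displacement x p g) +
        braket f (displacement x p (SchwartzMap.derivCLM ℂ ℂ g))) := by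
  have h := braket_deriv f (displacement x p g)
  rw [deriv_displacement, braket_add_right, braket_smul_right] at h
  linear_combination (-Complex.I) * h + p * braket f (displacement x p g) * Complex.I_sq

/-- A weight `w(x,p)` against which all matrix elements of displacements are bounded. -/
def IsBoundedWeight (w : ℝ → ℝ → ℝ) : Prop :=
  ∀ f g : 𝓢(ℝ, ℂ), ∃ K : ℝ, ∀ x p : ℝ, |w x p| * ‖braket f (displacement x p g)‖ ≤ K

theorem isBoundedWeight_one : IsBoundedWeight fun _ _ => 1 := by
  intro f g
  obtain ⟨C, hC⟩ : ∃ C : ℝ, ∀ y, ‖g y‖ ≤ C := by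
    obtain ⟨C, -, hC⟩ := g.decay 0 0
    exact ⟨C, fun y => by simpa using hC y⟩
  refine ⟨∫ y, ‖f y‖ * C, fun x p => ?_⟩
  rw [abs_one, one_mul]
  refine MeasureTheory.norm_integral_le_of_norm_le (f.integrable.norm.mul_const C) ?_
  refine Filter.Eventually.of_forall fun y => ?_
  rw [norm_mul, RCLike.norm_conj, norm_displacement_apply]
  exact mul_le_mul_of_nonneg_left (hC _) (norm_nonneg _)

theorem IsBoundedWeight.mul_left {w : ℝ → ℝ → ℝ} (hw : IsBoundedWeight w) :
    IsBoundedWeight fun x p => x * w x p := by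
  intro f g
  obtain ⟨K, hK⟩ := hw (position f) g
  obtain ⟨K', hK'⟩ := hw f (position g)
  refine ⟨K + K', fun x p => ?_⟩
  have h : |x| * ‖braket f (displacement x p g)‖ ≤ ‖braket (position f) (displacement x p g)‖ +
      ‖braket f (displacement x p (position g))‖ := by
    rw [← Real.norm_eq_abs, ← Complex.norm_real x, ← norm_mul, mul_braket_displacement]
    exact norm_sub_le _ _
  calc |x * w x p| * ‖braket f (displacement x p g)‖
      = |w x p| * (|x| * ‖braket f (displacement x p g)‖) := by rw [abs_mul]; ring
    _ ≤ |w x p| * (_ + _) := mul_le_mul_of_nonneg_left h (abs_nonneg _)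
    _ ≤ K + K' := by rw [mul_add]; exact add_le_add (hK x p) (hK' x p)

theorem IsBoundedWeight.mul_right {w : ℝ → ℝ → ℝ} (hw : IsBoundedWeight w) :
    IsBoundedWeight fun x p => p * w x p := by
  intro f g
  obtain ⟨K, hK⟩ := hw (SchwartzMap.derivCLM ℂ ℂ f) g
  obtain ⟨K', hK'⟩ := hw f (SchwartzMap.derivCLM ℂ ℂ g)
  refine ⟨K + K', fun x p => ?_⟩
  have h : |p| * ‖braket f (displacement x p g)‖ ≤
      ‖braket (SchwartzMap.derivCLM ℂ ℂ f) (displacement x p g)‖ +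
      ‖braket f (displacement x p (SchwartzMap.derivCLM ℂ ℂ g))‖ := by
    rw [← Real.norm_eq_abs, ← Complex.norm_real p, ← norm_mul, mul_braket_displacement', norm_mul, Complex.norm_I,
      one_mul]
    exact norm_add_le _ _
  calc |p * w x p| * ‖braket f (displacement x p g)‖
      = |w x p| * (|p| * ‖braket f (displacement x p g)‖) := by rw [abs_mul]; ring
    _ ≤ |w x p| * (_ + _) := mul_le_mul_of_nonneg_left h (abs_nonneg _)
    _ ≤ K + K' := by rw [mul_add]; exact add_le_add (hK x p) (hK' x p)

/-- The matrix elements of `D(x,p)` between Schwartz functions decay in `x` and `p`. -/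
theorem exists_norm_braket_displacement_le (f g : 𝓢(ℝ, ℂ)) :
    ∃ K : ℝ, ∀ x p : ℝ,
      ‖braket f (displacement x p g)‖ ≤ K * (((1 + |x|) ^ 2)⁻¹ * ((1 + |p|) ^ 2)⁻¹) := by
  have h0 := isBoundedWeight_one
  obtain ⟨K1, h1⟩ := h0 f g
  obtain ⟨K2, h2⟩ := h0.mul_left.mul_left f g
  obtain ⟨K3, h3⟩ := h0.mul_right.mul_right f g
  obtain ⟨K4, h4⟩ := h0.mul_right.mul_right.mul_left.mul_left f g
  refine ⟨4 * (K1 + K2 + K3 + K4), fun x p => ?_⟩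
  have e1 := h1 x p
  have e2 := h2 x p
  have e3 := h3 x p
  have e4 := h4 x p
  simp only [mul_one, abs_one, one_mul, abs_mul] at e1 e2 e3 e4
  rw [← mul_inv, ← div_eq_mul_inv, le_div_iff₀ (by positivity)]
  set b := ‖braket f (displacement x p g)‖ with hb
  have hb0 : 0 ≤ b := norm_nonneg _
  have hx : (1 + |x|) ^ 2 ≤ 2 * (1 + |x| * |x|) := by nlinarith [sq_nonneg (|x| - 1)]
  have hp : (1 + |p|) ^ 2 ≤ 2 * (1 + |p| * |p|) := by nlinarith [sq_nonneg (|p| - 1)]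
  calc b * ((1 + |x|) ^ 2 * (1 + |p|) ^ 2)
      ≤ b * ((2 * (1 + |x| * |x|)) * (2 * (1 + |p| * |p|))) := by gcongr
    _ = 4 * (b + |x| * |x| * b + |p| * |p| * b + |x| * (|x| * (|p| * |p|)) * b) := by ring
    _ ≤ 4 * (K1 + K2 + K3 + K4) := by
      have e2' : |x| * |x| * b ≤ K2 := e2
      linarith

theorem step_pos {d : ℕ} (hd : 0 < d) : 0 < step d := by
  have hd' : (0 : ℝ) < d := by exact_mod_cast hd
  exact Real.sqrt_pos.mpr (by positivity)

theorem summable_braket_displacement {d : ℕ} (hd : 0 < d) (f g : 𝓢(ℝ, ℂ)) :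
    Summable fun ν : ℤ × ℤ => ‖braket f (displacement (ν.2 * step d) (ν.1 * step d) g)‖ := by
  obtain ⟨K, hK⟩ := exists_norm_braket_displacement_le f g
  have h1 : Summable (fun n : ℤ => ((1 + |(n : ℝ) * step d|) ^ 2)⁻¹) := by
    simpa [mul_comm] using summable_inv_comb 0 (step d) (step_pos hd).ne'
  have h2 := ((h1.mul_of_nonneg h1 (fun n => by positivity) (fun n => by positivity))).mul_left K
  refine Summable.of_nonneg_of_le (fun _ => norm_nonneg _) (fun ν => ?_) h2
  refine (hK _ _).trans (le_of_eq ?_)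
  ring

theorem summable_zakGrossTerm {d : ℕ} (hd : 0 < d) (f g : 𝓢(ℝ, ℂ)) :
    Summable (zakGrossTerm d f g) := by
  refine Summable.of_norm ?_
  refine (summable_braket_displacement hd f g).congr fun ν => ?_
  simp [zakGrossTerm, norm_zpow]

/-- Displacing the arguments of a matrix element of a displacement multiplies it by a phase. -/
theorem braket_displacement_conj (u v x p : ℝ) (f g : 𝓢(ℝ, ℂ)) :
    braket (displacement (-u) (-v) f) (displacement x p (displacement (-u) (-v) g)) =
      Complex.exp (Complex.I * (v * x - u * p : ℝ)) * braket f (displacement x p g) := by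
  rw [← braket_displacement, displacement_displacement, displacement_displacement,
    smul_smul, braket_smul_right, ← Complex.exp_add]
  rw [show u + x + -u = x by ring, show v + p + -v = p by ring]
  congr 2
  push_cast
  ring

theorem norm_torusHarmonic (d : ℕ) (ν : ℤ × ℤ) (Ω : ℝ × ℝ) :
    ‖torusHarmonic d ν Ω‖ = (√(2 * Real.pi))⁻¹ := by
  rw [torusHarmonic, norm_mul, norm_inv, Complex.norm_real, Real.norm_of_nonneg (Real.sqrt_nonneg _)]
  have : ‖Complex.exp (Complex.I * step d * (ν.2 * Ω.2 - ν.1 * Ω.1))‖ = 1 := by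
    rw [← Complex.norm_exp_ofReal_mul_I (step d * (ν.2 * Ω.2 - ν.1 * Ω.1))]
    congr 2; push_cast; ring
  rw [this, mul_one]

theorem inv_sqrt_mul_inv_sqrt :
    ((√(2 * Real.pi))⁻¹ : ℂ) * ((√(2 * Real.pi))⁻¹ : ℂ) = 1 / (2 * Real.pi) := by
  rw [← mul_inv, ← Complex.ofReal_mul, Real.mul_self_sqrt (by positivity)]
  push_cast
  rw [one_div]

/-- The Zak--Gross kernel as a series in the harmonic functions. -/
theorem zakGrossKernel_eq_tsum (d : ℕ) (Ω : ℝ × ℝ) (f g : 𝓢(ℝ, ℂ)) :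
    zakGrossKernel d Ω f g = ∑' ν : ℤ × ℤ,
      torusHarmonic d ν Ω * (((√(2 * Real.pi))⁻¹ : ℂ) * zakGrossTerm d f g ν) := by
  rw [zakGrossKernel, zakGrossOrigin, ← tsum_mul_left]
  congr 1; funext ν
  rw [zakGrossTerm, braket_displacement_conj, torusHarmonic, zakGrossTerm,
    ← inv_sqrt_mul_inv_sqrt]
  have : Complex.I * ((Ω.2 * (ν.2 * step d) - Ω.1 * (ν.1 * step d) : ℝ) : ℂ)
      = Complex.I * step d * (ν.2 * Ω.2 - ν.1 * Ω.1) := by push_cast; ring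
  rw [this]
  ring

/-! ### Code kets as Dirac combs with periodic amplitudes -/

section

variable {d : ℕ}

theorem step_sq (hd : 0 < d) : step d * step d = 2 * Real.pi / d :=
  Real.mul_self_sqrt (by positivity)

theorem period_mul_step (hd : 0 < d) : (d * step d) * step d = 2 * Real.pi := by
  have hd' : (d : ℝ) ≠ 0 := by exact_mod_cast hd.ne'
  rw [mul_assoc, step_sq hd]
  field_simp

/-- The residues `0, …, d - 1` as elements of `ZMod d`. -/
def finEquivZMod (d : ℕ) [NeZero d] : Fin d ≃ ZMod d where
  toFun j := ((j : ℕ) : ZMod d)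
  invFun z := ⟨z.val, z.val_lt⟩
  left_inv j := Fin.ext (ZMod.val_cast_of_lt j.isLt)
  right_inv z := ZMod.natCast_zmod_val z

theorem finEquivZMod_apply [NeZero d] (j : Fin d) : finEquivZMod d j = ((j : ℕ) : ZMod d) := rfl

/-- Splitting a sum over the integers according to residues modulo `d`. -/
theorem tsum_int_eq_sum_tsum [NeZero d] {F : ℤ → ℂ} (hF : Summable F) :
    ∑' q, F q = ∑ j : Fin d, ∑' n : ℤ, F (j + d * n) := by
  let e : ℤ ≃ Fin d × ℤ := (Int.divModEquiv d).trans (Equiv.prodComm _ _)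
  have he : ∀ p : Fin d × ℤ, e.symm p = p.1 + d * p.2 := fun p => by
    simp [e, Int.divModEquiv_symm_apply]; ring
  have hF' : Summable fun p : Fin d × ℤ => F (p.1 + d * p.2) := by
    refine (e.symm.summable_iff.mpr hF).congr fun p => ?_
    simp [he]
  rw [← e.symm.tsum_eq, ← tsum_fintype (L := SummationFilter.unconditional _), ← hF'.tsum_prod]
  simp only [he]

/-- The element of the code space with amplitudes `C`, indexed by residues modulo `d`. -/
noncomputable def codeKet (d : ℕ) [NeZero d] (C : ZMod d → ℂ) : Ket :=
  encode d (C ∘ finEquivZMod d)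

theorem exists_norm_le_of_finite {ι : Type*} [Finite ι] (C : ι → ℂ) :
    ∃ K : ℝ, 0 ≤ K ∧ ∀ i, ‖C i‖ ≤ K := by
  obtain ⟨K, hK⟩ := (Set.finite_range fun i => ‖C i‖).bddAbove
  exact ⟨max K 0, le_max_right _ _, fun i => (hK ⟨i, rfl⟩).trans (le_max_left _ _)⟩

theorem norm_exp_I_mul (t : ℝ) : ‖Complex.exp (Complex.I * t)‖ = 1 := by
  rw [mul_comm]; exact Complex.norm_exp_ofReal_mul_I t

theorem summable_codeKet [NeZero d] (C : ZMod d → ℂ) (f : 𝓢(ℝ, ℂ)) :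
    Summable fun q : ℤ => C q * conj (f (q * step d)) := by
  obtain ⟨K, hK, hC⟩ := exists_norm_le_of_finite C
  have h := (summable_comb 0 (step d) (step_pos (NeZero.pos d)).ne' f).norm.mul_left K
  refine Summable.of_norm_bounded h fun q => ?_
  rw [norm_mul, zero_add, mul_comm (q : ℝ)]
  exact mul_le_mul_of_nonneg_right (hC _) (norm_nonneg _)

theorem codeKet_apply [NeZero d] (C : ZMod d → ℂ) (f : 𝓢(ℝ, ℂ)) :
    codeKet d C f = ((√(step d))⁻¹ : ℂ) * ∑' q : ℤ, C q * conj (f (q * step d)) := by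
  rw [tsum_int_eq_sum_tsum (d := d) (summable_codeKet C f), codeKet, encode,
    Fintype.linearCombination_apply, sum_apply, Finset.mul_sum]
  refine Finset.sum_congr rfl fun j _ => ?_
  rw [codeword, smul_apply, smul_apply, comb_apply, smul_eq_mul, smul_eq_mul,
    mul_left_comm, ← tsum_mul_left]
  congr 2
  funext n
  rw [Function.comp_apply, finEquivZMod_apply]
  congr 2
  · push_cast
    simp
  · push_cast
    congr 2
    ring

theorem exists_eq_codeKet [NeZero d] {ψ : Ket} (hψ : ψ ∈ codeSpace d) :
    ∃ C : ZMod d → ℂ, ψ = codeKet d C := by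
  rw [codeSpace, ← Fintype.range_linearCombination] at hψ
  obtain ⟨c, hc⟩ := hψ
  refine ⟨c ∘ (finEquivZMod d).symm, ?_⟩
  rw [← hc, codeKet, Function.comp_assoc, Equiv.symm_comp_self, Function.comp_id, encode]

theorem codeKet_mem [NeZero d] (C : ZMod d → ℂ) : codeKet d C ∈ codeSpace d := by
  rw [codeSpace, ← Fintype.range_linearCombination]
  exact ⟨_, rfl⟩

theorem codeKet_smul [NeZero d] (c : ℂ) (C : ZMod d → ℂ) :
    codeKet d (c • C) = c • codeKet d C := by
  rw [codeKet, codeKet, ← map_smul]; rfl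

/-- A bump function around `qℓ` isolates a single amplitude of a code ket. -/
theorem exists_codeKet_apply_eq [NeZero d] (q : ℤ) :
    ∃ f : 𝓢(ℝ, ℂ), ∀ C : ZMod d → ℂ, codeKet d C f = ((√(step d))⁻¹ : ℂ) * C q := by
  have hl := step_pos (NeZero.pos d)
  let b : ContDiffBump ((q : ℝ) * step d) := ⟨step d / 3, step d / 2, by positivity, by linarith⟩
  have h1 : HasCompactSupport fun y => (b y : ℂ) :=
    b.hasCompactSupport.comp_left (g := fun r : ℝ => (r : ℂ)) Complex.ofReal_zero
  have h2 : ContDiff ℝ ((⊤ : ℕ∞) : WithTop ℕ∞) fun y => (b y : ℂ) :=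
    Complex.ofRealCLM.contDiff.comp b.contDiff
  refine ⟨h1.toSchwartzMap h2, fun C => ?_⟩
  rw [codeKet_apply, tsum_eq_single q]
  · have : b ((q : ℝ) * step d) = 1 :=
      b.one_of_mem_closedBall (Metric.mem_closedBall_self (by positivity))
    simp [this]
  · intro n hn
    have : b ((n : ℝ) * step d) = 0 := by
      refine b.zero_of_le_dist ?_
      have h : (1 : ℝ) ≤ |((n - q : ℤ) : ℝ)| := by
        rw [← Int.cast_abs]
        exact_mod_cast Int.one_le_abs (sub_ne_zero.mpr hn)
      rw [Real.dist_eq, ← sub_mul, abs_mul, abs_of_pos hl]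
      push_cast at h
      change step d / 2 ≤ _
      nlinarith
    simp [this]

theorem codeKet_injective [NeZero d] : Function.Injective (codeKet d) := by
  intro C C' h
  funext z
  obtain ⟨f, hf⟩ := exists_codeKet_apply_eq (d := d) (z.val : ℤ)
  have hl : ((√(step d))⁻¹ : ℂ) ≠ 0 :=
    inv_ne_zero (Complex.ofReal_ne_zero.mpr (Real.sqrt_pos.mpr (step_pos (NeZero.pos d))).ne')
  have := mul_left_cancel₀ hl ((hf C).symm.trans ((DFunLike.congr_fun h f).trans (hf C')))
  simpa using this

/-- Linear independence of the codewords; it makes `amplitudes`, an `invFun` of the encoding, a genuine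
left inverse. -/
theorem encode_injective [NeZero d] : Function.Injective (encode d) := by
  intro c c' h
  have : codeKet d (c ∘ (finEquivZMod d).symm) = codeKet d (c' ∘ (finEquivZMod d).symm) := by
    simpa [codeKet, Function.comp_assoc] using h
  have := codeKet_injective this
  exact (finEquivZMod d).symm.surjective.injective_comp_right this

theorem codeInner_codeKet [NeZero d] (C C' : ZMod d → ℂ) :
    codeInner d (codeKet d C) (codeKet d C') = ∑ z, conj (C z) * C' z := by
  simp only [codeInner, amplitudes, codeKet,
    Function.leftInverse_invFun (encode_injective (d := d)) _, Function.comp_apply]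
  exact (finEquivZMod d).sum_comp fun z => conj (C z) * C' z

/-! ### Displaced code kets -/

theorem displacement_neg_conj (x p : ℝ) (f : 𝓢(ℝ, ℂ)) (y : ℝ) :
    conj (displacement (-x) (-p) f y) =
      Complex.exp (Complex.I * (x * p / 2 : ℝ)) *
        (Complex.exp (Complex.I * (p * y : ℝ)) * conj (f (y + x))) := by
  rw [displacement_apply, map_mul, map_mul, ← Complex.exp_conj, ← Complex.exp_conj]
  simp only [map_neg, map_mul, map_div₀, Complex.conj_I, Complex.conj_ofReal, map_ofNat,
    sub_neg_eq_add]
  rw [mul_assoc]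
  congr 2
  · push_cast; ring_nf
  · congr 1; push_cast; ring_nf

/-- The displaced Dirac comb `⟨f|D(x,p)|ψ⟩`. -/
theorem dispKet_codeKet_apply [NeZero d] (x p : ℝ) (C : ZMod d → ℂ) (f : 𝓢(ℝ, ℂ)) :
    dispKet x p (codeKet d C) f =
      ((√(step d))⁻¹ : ℂ) * Complex.exp (Complex.I * (x * p / 2 : ℝ)) *
        ∑' q : ℤ, C q * (Complex.exp (Complex.I * (p * (q * step d) : ℝ)) *
          conj (f (q * step d + x))) := by
  rw [dispKet_apply, codeKet_apply, mul_assoc]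
  congr 1
  rw [← tsum_mul_left]
  congr 1
  funext q
  rw [displacement_neg_conj]
  ring

theorem exp_eq_stdAddChar [NeZero d] (k : ℤ) :
    Complex.exp (Complex.I * (step d * step d * k : ℝ)) = ZMod.stdAddChar (k : ZMod d) := by
  rw [ZMod.stdAddChar_coe, step_sq (NeZero.pos d)]
  congr 1
  push_cast
  ring

/-- The amplitudes of a code ket after the displacement by `(nℓ, mℓ)`, up to a global phase. -/
noncomputable def shiftAmp [NeZero d] (n m : ZMod d) (C : ZMod d → ℂ) : ZMod d → ℂ :=
  fun z => ZMod.stdAddChar (m * (z - n)) * C (z - n)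

/-- Displacements by integer multiples of `ℓ` preserve the code space. -/
theorem dispKet_codeKet [NeZero d] (n m : ℤ) (C : ZMod d → ℂ) :
    dispKet (n * step d) (m * step d) (codeKet d C) =
      Complex.exp (Complex.I * ((n * step d) * (m * step d) / 2 : ℝ)) •
        codeKet d (shiftAmp n m C) := by
  ext f
  rw [smul_apply, dispKet_codeKet_apply, codeKet_apply, smul_eq_mul,
    mul_comm ((√(step d))⁻¹ : ℂ), mul_assoc]
  congr 2
  rw [← (Equiv.addRight n).tsum_eq (fun q : ℤ => shiftAmp (n : ZMod d) m C q * _)]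
  congr 1
  funext q
  simp only [Equiv.coe_addRight, shiftAmp]
  have h1 : ((q + n : ℤ) : ZMod d) - n = q := by push_cast; ring
  have h2 : (q : ℝ) * step d + n * step d = ((q + n : ℤ) : ℝ) * step d := by push_cast; ring
  have h3 : ((m * step d) * (q * step d) : ℝ) = step d * step d * ((m * q : ℤ) : ℝ) := by
    push_cast; ring
  rw [h1, h2, h3, exp_eq_stdAddChar]
  push_cast
  ring

theorem dispKet_period_left [NeZero d] {ψ : Ket} (hψ : ψ ∈ codeSpace d) :
    dispKet (d * step d) 0 ψ = ψ := by
  obtain ⟨C, rfl⟩ := exists_eq_codeKet hψ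
  have h := dispKet_codeKet (d : ℤ) 0 C
  simp only [Int.cast_natCast, Int.cast_zero, zero_mul, mul_zero, zero_div, Complex.ofReal_zero,
    Complex.exp_zero, one_smul] at h
  rw [h]
  congr 1
  funext z
  simp [shiftAmp]

theorem dispKet_period_right [NeZero d] {ψ : Ket} (hψ : ψ ∈ codeSpace d) :
    dispKet 0 (d * step d) ψ = ψ := by
  obtain ⟨C, rfl⟩ := exists_eq_codeKet hψ
  have h := dispKet_codeKet 0 (d : ℤ) C
  simp only [Int.cast_natCast, Int.cast_zero, zero_mul, mul_zero, zero_div, Complex.ofReal_zero,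
    Complex.exp_zero, one_smul] at h
  rw [h]
  congr 1
  funext z
  simp [shiftAmp]

theorem dispKet_zero (ψ : Ket) : dispKet 0 0 ψ = ψ := by
  ext f; simp [dispKet_apply, displacement_zero]

theorem dispKet_ne_zero {ψ : Ket} (hψ : ψ ≠ 0) (x p : ℝ) : dispKet x p ψ ≠ 0 := by
  intro h
  apply hψ
  have h2 := dispKet_dispKet (-x) (-p) x p ψ
  rw [h, neg_add_cancel, neg_add_cancel, dispKet_zero] at h2
  have h3 : dispKet (-x) (-p) (0 : Ket) = 0 := rfl
  rw [h3] at h2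
  exact (smul_eq_zero.mp h2.symm).resolve_left (Complex.exp_ne_zero _)

/-- If `D(x,p)ψ` and `ψ` are both fixed by `D(y,q)`, then `D(x,p)` and `D(y,q)` commute, i.e.
`qx - yp` is a multiple of `2π`. -/
theorem exists_int_of_dispKet_fixed {ψ : Ket} (hψ : ψ ≠ 0) {x p y q : ℝ}
    (h1 : dispKet y q ψ = ψ) (h2 : dispKet y q (dispKet x p ψ) = dispKet x p ψ) :
    ∃ k : ℤ, q * x - y * p = k * (2 * Real.pi) := by
  have e1 := dispKet_dispKet y q x p ψ
  have e2 := dispKet_dispKet x p y q ψ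
  rw [h2] at e1
  rw [h1, e1, add_comm x, add_comm p] at e2
  have hne := dispKet_ne_zero hψ (y + x) (q + p)
  have e3 := smul_left_injective ℂ hne e2
  obtain ⟨k, hk⟩ := Complex.exp_eq_exp_iff_exists_int.mp e3
  refine ⟨k, ?_⟩
  have h4 : (((q * x - y * p : ℝ) : ℂ)) * Complex.I = ((k * (2 * Real.pi) : ℝ) : ℂ) * Complex.I := by
    push_cast at hk ⊢
    linear_combination hk
  exact_mod_cast mul_right_cancel₀ Complex.I_ne_zero h4

/-- Displaced code spaces meet the code space only for displacements by multiples of `ℓ`. -/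
theorem exists_int_of_dispKet_mem [NeZero d] {ψ : Ket} (hψ : ψ ∈ codeSpace d) (h0 : ψ ≠ 0)
    {x p : ℝ} (h : dispKet x p ψ ∈ codeSpace d) :
    ∃ n m : ℤ, x = n * step d ∧ p = m * step d := by
  have hl := step_pos (NeZero.pos d)
  have hd : (0 : ℝ) < d := by exact_mod_cast NeZero.pos d
  have hL := period_mul_step (NeZero.pos d)
  obtain ⟨n, hn⟩ := exists_int_of_dispKet_fixed h0 (dispKet_period_right hψ)
    (dispKet_period_right h)
  obtain ⟨m, hm⟩ := exists_int_of_dispKet_fixed h0 (dispKet_period_left hψ)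
    (dispKet_period_left h)
  have hne : (d : ℝ) * step d ≠ 0 := by positivity
  refine ⟨n, -m, mul_left_cancel₀ hne ?_, mul_left_cancel₀ hne ?_⟩
  · rw [← hL] at hn; linear_combination hn
  · rw [← hL] at hm; push_cast; linear_combination -hm

end

/-! ### The discrete ambiguity function and the coherent overlaps -/

section

variable {d : ℕ} [NeZero d]

/-- The discrete ambiguity function of the amplitudes `C`: up to a phase, the expectation value of
the displacement by `(aℓ, bℓ)`. -/
noncomputable def ambiguity (C : ZMod d → ℂ) (a b : ZMod d) : ℂ :=
  ∑ z, conj (C (z + a)) * (ZMod.stdAddChar (b * z) * C z)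

theorem conj_stdAddChar (z : ZMod d) :
    conj (ZMod.stdAddChar z) = ZMod.stdAddChar (-z) :=
  (AddChar.map_neg_eq_conj _ z).symm

theorem sum_stdAddChar_mul (c : ZMod d) :
    ∑ b : ZMod d, ZMod.stdAddChar (b * c) = if c = 0 then (d : ℂ) else 0 := by
  have h := AddChar.sum_mulShift c (ZMod.isPrimitive_stdAddChar d)
  rw [ZMod.card] at h
  rw [h]
  split_ifs <;> simp

/-- The squared modulus of the ambiguity function is its own symplectic Fourier transform. -/
theorem sum_ambiguity_mul_conj (C : ZMod d → ℂ) (n m : ZMod d) :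
    ∑ a, ∑ b, ambiguity C a b * conj (ambiguity C a b) * ZMod.stdAddChar (m * a - n * b) =
      d * (ambiguity C n m * conj (ambiguity C n m)) := by
  have h1 : ∀ a b, ambiguity C a b * conj (ambiguity C a b) * ZMod.stdAddChar (m * a - n * b) =
      ∑ k, ∑ j, conj (C (j + a)) * C j * (C (k + a) * conj (C k)) * ZMod.stdAddChar (m * a) *
        ZMod.stdAddChar (b * (j - k - n)) := by
    intro a b
    simp only [ambiguity, map_sum, map_mul, Complex.conj_conj, conj_stdAddChar]
    rw [Finset.sum_mul_sum, Finset.sum_comm, Finset.sum_mul]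
    refine Finset.sum_congr rfl fun k _ => ?_
    rw [Finset.sum_mul]
    refine Finset.sum_congr rfl fun j _ => ?_
    rw [show m * a - n * b = m * a + -(n * b) by ring,
      show b * (j - k - n) = b * j + -(b * k) + -(n * b) by ring]
    simp only [AddChar.map_add_eq_mul]
    ring
  have h2 : ∀ a, ∑ b, ambiguity C a b * conj (ambiguity C a b) *
      ZMod.stdAddChar (m * a - n * b) =
      ∑ k, d * (conj (C (k + n + a)) * C (k + n) * (C (k + a) * conj (C k)) *
        ZMod.stdAddChar (m * a)) := by
    intro a
    simp only [h1]
    rw [Finset.sum_comm]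
    refine Finset.sum_congr rfl fun k _ => ?_
    rw [Finset.sum_comm]
    -- the sum over `b` forces `j = k + n`
    simp only [← Finset.mul_sum, sum_stdAddChar_mul]
    rw [Finset.sum_eq_single (k + n)]
    · rw [if_pos (by ring)]; ring
    · intro j _ hj
      rw [if_neg, mul_zero]
      intro h
      exact hj (by linear_combination h)
    · simp
  simp only [h2]
  rw [Finset.sum_comm]
  have h3 : ∀ k, ∑ a, (d : ℂ) * (conj (C (k + n + a)) * C (k + n) * (C (k + a) * conj (C k)) *
        ZMod.stdAddChar (m * a)) =
      ∑ s, (d : ℂ) * ((conj (C (s + n)) * (ZMod.stdAddChar (m * s) * C s)) *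
        (C (k + n) * (ZMod.stdAddChar (-(m * k)) * conj (C k)))) := by
    intro k
    -- substituting `s = k + a` decouples the two sums
    rw [← Equiv.sum_comp (Equiv.addLeft k) (fun s => (d : ℂ) *
      ((conj (C (s + n)) * (ZMod.stdAddChar (m * s) * C s)) *
        (C (k + n) * (ZMod.stdAddChar (-(m * k)) * conj (C k)))))]
    refine Finset.sum_congr rfl fun a _ => ?_
    simp only [Equiv.coe_addLeft]
    have e : m * (k + a) = m * k + m * a := by ring
    have e' : (ZMod.stdAddChar (m * k) : ℂ) * ZMod.stdAddChar (-(m * k)) = 1 := by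
      rw [← AddChar.map_add_eq_mul, add_neg_cancel, AddChar.map_zero_eq_one]
    rw [show k + n + a = k + a + n by ring, e, AddChar.map_add_eq_mul]
    linear_combination (-(d : ℂ) * conj (C (k + a + n)) * C (k + n) * C (k + a) * conj (C k) *
        ZMod.stdAddChar (m * a)) * e'
  simp only [h3, ← Finset.mul_sum]
  rw [Finset.sum_congr rfl fun k _ => (Finset.sum_mul _ _ _).symm]
  simp only [ambiguity, map_sum, map_mul, Complex.conj_conj, conj_stdAddChar, ← Finset.mul_sum]

theorem codeInner_shiftAmp (C : ZMod d → ℂ) (n m : ZMod d) :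
    codeInner d (codeKet d C) (codeKet d (shiftAmp n m C)) = ambiguity C n m := by
  rw [codeInner_codeKet, ambiguity, ← Equiv.sum_comp (Equiv.addRight n)]
  simp [shiftAmp]

theorem codeInner_dispKet (C : ZMod d → ℂ) (n m : ℤ) :
    codeInner d (codeKet d C) (dispKet (n * step d) (m * step d) (codeKet d C)) =
      Complex.exp (Complex.I * ((n * step d) * (m * step d) / 2 : ℝ)) * ambiguity C n m := by
  rw [dispKet_codeKet, ← codeKet_smul, ← codeInner_shiftAmp, codeInner_codeKet, codeInner_codeKet,
    Finset.mul_sum]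
  refine Finset.sum_congr rfl fun z _ => ?_
  simp only [Pi.smul_apply, smul_eq_mul]
  ring

theorem norm_codeInner_dispKet (C : ZMod d → ℂ) (n m : ℤ) :
    ‖codeInner d (codeKet d C) (dispKet (n * step d) (m * step d) (codeKet d C))‖ =
      ‖ambiguity C n m‖ := by
  rw [codeInner_dispKet, norm_mul, norm_exp_I_mul, one_mul]

/-- The overlap of coherent kets at a distance `ℓ(n,m)`; the phases of the group law drop out. -/
theorem norm_overlap (C : ZMod d → ℂ) (u v : ℝ) (n m : ℤ) :
    ‖overlap d (codeKet d C) (u, v) (u + n * step d, v + m * step d)‖ = ‖ambiguity C n m‖ := by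
  have h : dispKet (-u) (-v) (coherent (codeKet d C) (u + n * step d, v + m * step d)) =
      codeKet d ((Complex.exp (Complex.I *
        ((-v * (u + n * step d) - -u * (v + m * step d)) / 2 : ℝ)) *
        Complex.exp (Complex.I * ((n * step d) * (m * step d) / 2 : ℝ))) • shiftAmp n m C) := by
    rw [coherent, dispKet_dispKet, neg_add_cancel_left, neg_add_cancel_left, dispKet_codeKet,
      smul_smul, codeKet_smul]
  rw [overlap, h, if_pos (codeKet_mem _), codeInner_codeKet]
  simp only [Pi.smul_apply, smul_eq_mul, mul_left_comm _ (_ * _), ← Finset.mul_sum]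
  rw [norm_mul, norm_mul, norm_exp_I_mul, norm_exp_I_mul, one_mul, one_mul, ← codeInner_codeKet,
    codeInner_shiftAmp]

theorem exists_int_of_overlap_ne_zero {ψ : Ket} (hψ : ψ ∈ codeSpace d) (h0 : ψ ≠ 0)
    {u v u' v' : ℝ} (h : overlap d ψ (u, v) (u', v') ≠ 0) :
    ∃ n m : ℤ, u' = u + n * step d ∧ v' = v + m * step d := by
  have h1 : dispKet (-u) (-v) (coherent ψ (u', v')) ∈ codeSpace d := by
    by_contra h1
    exact h (if_neg h1)
  rw [coherent, dispKet_dispKet,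
    Submodule.smul_mem_iff _ (Complex.exp_ne_zero _)] at h1
  obtain ⟨n, m, hn, hm⟩ := exists_int_of_dispKet_mem hψ h0 h1
  exact ⟨n, m, by simp only at hn; linarith, by simp only at hm; linarith⟩

theorem conj_torusHarmonic_add (ν : ℤ × ℤ) (u v : ℝ) (a b : ℤ) :
    conj (torusHarmonic d ν (u + a * step d, v + b * step d)) =
      conj (torusHarmonic d ν (u, v)) * ZMod.stdAddChar ((ν.1 * a - ν.2 * b : ℤ) : ZMod d) := by
  have h := exp_eq_stdAddChar (d := d) (ν.1 * a - ν.2 * b)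
  rw [torusHarmonic, torusHarmonic, map_mul, map_mul, ← h, mul_assoc (conj _), ← Complex.exp_conj,
    ← Complex.exp_conj, ← Complex.exp_add]
  congr 2
  simp only [map_mul, map_sub, Complex.conj_I, Complex.conj_ofReal, map_intCast]
  push_cast
  ring

theorem period_pos : 0 < (d : ℝ) * step d := by
  have hd : (0 : ℝ) < d := by exact_mod_cast NeZero.pos d
  have := step_pos (NeZero.pos d)
  positivity

/-- The representative in the torus of the translate of `u` by a residue times `ℓ`. -/
noncomputable def torusShift (u : ℝ) (a : ZMod d) : ℝ :=
  toIcoMod (period_pos (d := d)) 0 (u + a.val * step d)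

theorem torusShift_mem (u : ℝ) (a : ZMod d) : torusShift u a ∈ Set.Ico 0 (d * step d) := by
  have h := toIcoMod_mem_Ico (period_pos (d := d)) 0 (u + a.val * step d)
  rwa [zero_add] at h

theorem exists_torusShift_eq (u : ℝ) (a : ZMod d) :
    ∃ n : ℤ, (n : ZMod d) = a ∧ torusShift u a = u + n * step d := by
  refine ⟨a.val - d * toIcoDiv (period_pos (d := d)) 0 (u + a.val * step d), by simp, ?_⟩
  rw [torusShift, ← self_sub_toIcoDiv_zsmul]
  push_cast
  rw [zsmul_eq_mul]
  ring

theorem torusShift_eq {u : ℝ} {n : ℤ} (h : u + n * step d ∈ Set.Ico 0 (d * step d)) :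
    torusShift u (n : ZMod d) = u + n * step d := by
  obtain ⟨n', hn', e⟩ := exists_torusShift_eq u (n : ZMod d)
  have h1 := torusShift_mem u (n : ZMod d)
  obtain ⟨k, hk⟩ := (ZMod.intCast_eq_intCast_iff_dvd_sub n' n d).mp hn'
  have hl := step_pos (NeZero.pos d)
  have hk' : (n : ℝ) - n' = d * k := by exact_mod_cast hk
  have hk0 : k = 0 := by
    rw [e] at h1
    have hL := period_pos (d := d)
    have e2 : (k : ℝ) * (d * step d) = (u + n * step d) - (u + n' * step d) := by
      linear_combination -step d * hk'
    have a1 : (k : ℝ) < 1 := by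
      by_contra hc; push Not at hc; nlinarith [h.1, h.2, h1.1, h1.2]
    have a2 : (-1 : ℝ) < k := by
      by_contra hc; push Not at hc; nlinarith [h.1, h.2, h1.1, h1.2]
    have a1' : k < 1 := by exact_mod_cast a1
    have a2' : -1 < k := by exact_mod_cast a2
    omega
  rw [e]
  rw [hk0] at hk'
  have : (n : ℝ) = n' := by simpa [sub_eq_zero] using hk'
  rw [this]

theorem torusShift_injective (u : ℝ) : Function.Injective (torusShift u : ZMod d → ℝ) := by
  intro a a' h
  obtain ⟨n, rfl, e⟩ := exists_torusShift_eq u a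
  obtain ⟨n', rfl, e'⟩ := exists_torusShift_eq u a'
  rw [e, e'] at h
  have := mul_right_cancel₀ (step_pos (NeZero.pos d)).ne' (add_left_cancel h)
  have : n = n' := by exact_mod_cast this
  rw [this]

/-- The Fourier coefficients of the overlap density: the Dirac comb at the points `Ω + ℓ(a,b)` of the
torus with weights `|A(a,b)|²` has the coefficients `|A(n,m)|²`. -/
theorem overlapPairing_codeKet {C : ZMod d → ℂ} (h0 : codeKet d C ≠ 0) (Ω : ℝ × ℝ) (κ : ℤ × ℤ) :
    overlapPairing d (codeKet d C) Ω (fun Ω' => conj (torusHarmonic d κ Ω')) =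
      ((‖ambiguity C κ.2 κ.1‖ ^ 2 : ℝ) : ℂ) * conj (torusHarmonic d κ Ω) := by
  obtain ⟨u, v⟩ := Ω
  let Θ : ZMod d × ZMod d → ℝ × ℝ := fun p => (torusShift u p.1, torusShift v p.2)
  have hΘ : Function.Injective Θ := fun p p' h =>
    Prod.ext (torusShift_injective u (congrArg Prod.fst h))
      (torusShift_injective v (congrArg Prod.snd h))
  -- reduce the finite sum over the torus to the image of `Θ`, which contains its support
  let G : ℝ × ℝ → ℂ := fun Ω' => ((‖overlap d (codeKet d C) (u, v) Ω'‖ ^ 2 : ℝ) : ℂ) *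
    conj (torusHarmonic d κ Ω')
  have hsupp : ∀ Ω' ∈ Function.support G, Ω' ∈ torus d ↔ Ω' ∈ Set.range Θ := by
    rintro ⟨u', v'⟩ h
    have h1 : overlap d (codeKet d C) (u, v) (u', v') ≠ 0 := by
      intro h1
      apply h
      simp [G, h1]
    obtain ⟨n, m, rfl, rfl⟩ := exists_int_of_overlap_ne_zero (codeKet_mem C) h0 h1
    constructor
    · rintro ⟨hu, hv⟩
      exact ⟨((n : ZMod d), (m : ZMod d)), Prod.ext (torusShift_eq hu) (torusShift_eq hv)⟩
    · rintro ⟨p, hp⟩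
      rw [← hp]
      exact ⟨torusShift_mem u p.1, torusShift_mem v p.2⟩
  have hG : ∀ p, G (Θ p) = conj (torusHarmonic d κ (u, v)) * (ambiguity C p.1 p.2 *
      conj (ambiguity C p.1 p.2) * ZMod.stdAddChar ((κ.1 : ZMod d) * p.1 - (κ.2 : ZMod d) * p.2)) := by
    rintro ⟨a, b⟩
    obtain ⟨n, rfl, e⟩ := exists_torusShift_eq u a
    obtain ⟨m, rfl, e'⟩ := exists_torusShift_eq v b
    simp only [G, Θ]
    rw [e, e', norm_overlap, conj_torusHarmonic_add, Complex.mul_conj, Complex.normSq_eq_norm_sq]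
    push_cast
    ring
  rw [overlapPairing]
  change 1 / (d : ℂ) * ∑ᶠ (Ω' : ℝ × ℝ) (_ : Ω' ∈ torus d), G Ω' = _
  rw [finsum_mem_inter_support_eq' G (torus d) (Set.range Θ) hsupp, finsum_mem_range hΘ,
    finsum_eq_sum_of_fintype, Finset.sum_congr rfl fun p _ => hG p, ← Finset.mul_sum,
    Fintype.sum_prod_type, sum_ambiguity_mul_conj, Complex.mul_conj, Complex.normSq_eq_norm_sq]
  have hd : (d : ℂ) ≠ 0 := by exact_mod_cast (NeZero.ne d)
  field_simp

end

/-! ### Integration over the torus -/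

open MeasureTheory

section

variable {d : ℕ} [NeZero d]

theorem torusMeasure_eq_smul_prod {d : ℕ} : torusMeasure d = ENNReal.ofReal (1 / d) •
    (volume.restrict (Set.Ico 0 (d * step d))).prod
      (volume.restrict (Set.Ico 0 (d * step d))) := by
  rw [Measure.prod_restrict]; rfl

instance : IsFiniteMeasure (torusMeasure d) := by
  rw [torusMeasure_eq_smul_prod]
  exact Measure.smul_finite _ ENNReal.ofReal_ne_top

theorem setLIntegral_Ico_add {T : ℝ} (hT : 0 < T) {f : ℝ → ENNReal} (hf : Function.Periodic f T)
    (a : ℝ) : ∫⁻ x in Set.Ico 0 T, f (x + a) = ∫⁻ x in Set.Ico 0 T, f x := by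
  have h1 := (measurePreserving_add_right (volume : Measure ℝ) a).setLIntegral_comp_preimage_emb
    (measurableEmbedding_addRight a) f (Set.Ico a (a + T))
  rw [Set.preimage_add_const_Ico, sub_self, add_sub_cancel_left] at h1
  rw [h1, setLIntegral_congr Ico_ae_eq_Ioc, setLIntegral_congr (Ico_ae_eq_Ioc (a := (0 : ℝ)))]
  have h2 := (isAddFundamentalDomain_Ioc hT a).setLIntegral_eq (isAddFundamentalDomain_Ioc hT 0) f
    hf.map_vadd_zmultiples
  rwa [zero_add] at h2

theorem isInvariantMeasure : IsInvariantMeasure d := by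
  intro F hF hu hv x p
  have hL := period_pos (d := d)
  have hF' : Measurable fun Ω : ℝ × ℝ => F (Ω.1 + x, Ω.2 + p) :=
    hF.comp (by fun_prop)
  rw [torusMeasure_eq_smul_prod, lintegral_smul_measure, lintegral_smul_measure,
    lintegral_prod _ hF'.aemeasurable, lintegral_prod _ hF.aemeasurable]
  congr 1
  have h1 : ∀ u, ∫⁻ v in Set.Ico 0 (d * step d), F (u + x, v + p)
      = ∫⁻ v in Set.Ico 0 (d * step d), F (u + x, v) := fun u =>
    setLIntegral_Ico_add hL (f := fun v => F (u + x, v)) (fun v => hv _ v) p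
  simp only [h1]
  exact setLIntegral_Ico_add hL (f := fun u => ∫⁻ v in Set.Ico 0 (d * step d), F (u, v))
    (fun u => by simp only [hu]) x

theorem integral_torusMeasure_mul {d : ℕ} (f g : ℝ → ℂ) :
    ∫ Ω, f Ω.1 * g Ω.2 ∂(torusMeasure d) = 1 / d *
      ((∫ u in Set.Ico 0 (d * step d), f u) * ∫ v in Set.Ico 0 (d * step d), g v) := by
  rw [torusMeasure_eq_smul_prod, integral_smul_measure, integral_prod_mul,
    ENNReal.toReal_ofReal (by positivity), Complex.real_smul]
  push_cast
  rfl

theorem exp_step_mul_period (k : ℤ) :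
    Complex.exp (Complex.I * step d * k * (d * step d : ℝ)) = 1 := by
  have h : (((d * step d) * step d : ℝ) : ℂ) = ((2 * Real.pi : ℝ) : ℂ) := by
    rw [period_mul_step (NeZero.pos d)]
  rw [← Complex.exp_int_mul_two_pi_mul_I k]
  congr 1
  push_cast at h ⊢
  linear_combination Complex.I * k * h

theorem integral_exp_Ico (k : ℤ) :
    ∫ v in Set.Ico 0 (d * step d), Complex.exp (Complex.I * step d * k * v) =
      if k = 0 then ((d * step d : ℝ) : ℂ) else 0 := by
  have hL := period_pos (d := d)
  rw [integral_Ico_eq_integral_Ioc, ← intervalIntegral.integral_of_le hL.le]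
  split_ifs with hk
  · simp [hk]
  · have hl : (step d : ℂ) ≠ 0 := by exact_mod_cast (step_pos (NeZero.pos d)).ne'
    have hk' : (k : ℂ) ≠ 0 := by exact_mod_cast hk
    rw [integral_exp_mul_complex (mul_ne_zero (mul_ne_zero Complex.I_ne_zero hl) hk'),
      exp_step_mul_period]
    simp

/-! ### The harmonic functions of the torus -/

theorem torusHarmonic_periodic (ν : ℤ × ℤ) (u v : ℝ) :
    torusHarmonic d ν (u + d * step d, v) = torusHarmonic d ν (u, v) ∧
      torusHarmonic d ν (u, v + d * step d) = torusHarmonic d ν (u, v) := by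
  constructor
  · rw [torusHarmonic, torusHarmonic, ← mul_one (Complex.exp (Complex.I * step d *
      (ν.2 * ((u, v) : ℝ × ℝ).2 - ν.1 * ((u, v) : ℝ × ℝ).1))), ← exp_step_mul_period (d := d) (-ν.1),
      ← Complex.exp_add]
    congr 2
    push_cast
    ring
  · rw [torusHarmonic, torusHarmonic, ← mul_one (Complex.exp (Complex.I * step d *
      (ν.2 * ((u, v) : ℝ × ℝ).2 - ν.1 * ((u, v) : ℝ × ℝ).1))), ← exp_step_mul_period (d := d) ν.2,
      ← Complex.exp_add]
    congr 2
    push_cast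
    ring

theorem hasDerivAt_torusHarmonic_fst {d : ℕ} (ν : ℤ × ℤ) (u v : ℝ) :
    HasDerivAt (fun r => torusHarmonic d ν (r, v))
      (-(Complex.I * step d * ν.1) * torusHarmonic d ν (u, v)) u := by
  have h : HasDerivAt (fun r : ℝ => Complex.I * step d * (ν.2 * v - ν.1 * r))
      (Complex.I * step d * -(ν.1 * 1)) u :=
    (((Complex.ofRealCLM.hasDerivAt (x := u)).const_mul (ν.1 : ℂ)).const_sub
      (ν.2 * v : ℂ)).const_mul (Complex.I * step d)
  have h' := h.cexp.const_mul ((√(2 * Real.pi))⁻¹ : ℂ)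
  refine h'.congr_deriv ?_
  rw [torusHarmonic]
  ring

theorem hasDerivAt_torusHarmonic_snd {d : ℕ} (ν : ℤ × ℤ) (u v : ℝ) :
    HasDerivAt (fun r => torusHarmonic d ν (u, r))
      (Complex.I * step d * ν.2 * torusHarmonic d ν (u, v)) v := by
  have h : HasDerivAt (fun r : ℝ => Complex.I * step d * (ν.2 * r - ν.1 * u))
      (Complex.I * step d * (ν.2 * 1)) v :=
    (((Complex.ofRealCLM.hasDerivAt (x := v)).const_mul (ν.2 : ℂ)).sub_const
      (ν.1 * u : ℂ)).const_mul (Complex.I * step d)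
  have h' := h.cexp.const_mul ((√(2 * Real.pi))⁻¹ : ℂ)
  refine h'.congr_deriv ?_
  rw [torusHarmonic]
  ring

theorem laplacian_torusHarmonic {d : ℕ} (ν : ℤ × ℤ) (u v : ℝ) :
    deriv (fun s => deriv (fun r => torusHarmonic d ν (r, v)) s) u +
      deriv (fun s => deriv (fun r => torusHarmonic d ν (u, r)) s) v =
      -((step d : ℂ) ^ 2 * ((ν.1 : ℂ) ^ 2 + (ν.2 : ℂ) ^ 2)) * torusHarmonic d ν (u, v) := by
  simp only [(hasDerivAt_torusHarmonic_fst ν _ v).deriv,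
    (hasDerivAt_torusHarmonic_snd ν u _).deriv]
  rw [((hasDerivAt_torusHarmonic_fst ν u v).const_mul _).deriv,
    ((hasDerivAt_torusHarmonic_snd ν u v).const_mul _).deriv]
  linear_combination (step d : ℂ) ^ 2 * ((ν.1 : ℂ) ^ 2 + (ν.2 : ℂ) ^ 2) *
    torusHarmonic d ν (u, v) * Complex.I_sq

theorem conj_torusHarmonic {d : ℕ} (ν : ℤ × ℤ) (Ω : ℝ × ℝ) :
    conj (torusHarmonic d ν Ω) = ((√(2 * Real.pi))⁻¹ : ℂ) *
      Complex.exp (Complex.I * step d * (ν.1 * Ω.1 - ν.2 * Ω.2)) := by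
  rw [torusHarmonic, map_mul, ← Complex.exp_conj]
  simp only [map_mul, map_sub, Complex.conj_I, Complex.conj_ofReal, map_intCast, map_inv₀]
  congr 2
  ring

theorem torusHarmonic_orthonormal (ν κ : ℤ × ℤ) :
    ∫ Ω, torusHarmonic d ν Ω * conj (torusHarmonic d κ Ω) ∂(torusMeasure d) =
      if ν = κ then 1 else 0 := by
  have h : ∀ Ω : ℝ × ℝ, torusHarmonic d ν Ω * conj (torusHarmonic d κ Ω) =
      1 / (2 * Real.pi) * (Complex.exp (Complex.I * step d * (κ.1 - ν.1 : ℤ) * Ω.1) *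
        Complex.exp (Complex.I * step d * (ν.2 - κ.2 : ℤ) * Ω.2)) := by
    intro Ω
    rw [conj_torusHarmonic, torusHarmonic, ← inv_sqrt_mul_inv_sqrt, mul_mul_mul_comm,
      ← Complex.exp_add, ← Complex.exp_add]
    congr 2
    push_cast
    ring
  simp only [h]
  rw [integral_const_mul, integral_torusMeasure_mul
    (fun u => Complex.exp (Complex.I * step d * (κ.1 - ν.1 : ℤ) * u))
    (fun v => Complex.exp (Complex.I * step d * (ν.2 - κ.2 : ℤ) * v)),
    integral_exp_Ico, integral_exp_Ico]
  have hL : (((d * step d) * step d : ℝ) : ℂ) = ((2 * Real.pi : ℝ) : ℂ) := by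
    rw [period_mul_step (NeZero.pos d)]
  have hd : (d : ℂ) ≠ 0 := by exact_mod_cast (NeZero.ne d)
  have hpi : (Real.pi : ℂ) ≠ 0 := by exact_mod_cast Real.pi_ne_zero
  by_cases hν : ν = κ
  · subst hν
    simp only [sub_self, if_true]
    push_cast at hL ⊢
    field_simp
    linear_combination hL
  · rw [if_neg hν]
    by_cases h1 : κ.1 - ν.1 = 0
    · have h2 : ν.2 - κ.2 ≠ 0 := fun h2 => hν (Prod.ext (by omega) (by omega))
      rw [if_neg h2, mul_zero, mul_zero, mul_zero]
    · rw [if_neg h1, zero_mul, mul_zero, mul_zero]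

/-- The scaled Lebesgue measure on `[0,T)` is the pullback of the measure of the unit circle. -/
theorem measurePreserving_div_coe {T : ℝ} (hT : 0 < T) :
    MeasurePreserving (fun u : ℝ => ((T⁻¹ * u : ℝ) : UnitAddCircle))
      (ENNReal.ofReal T⁻¹ • volume.restrict (Set.Ico 0 T)) AddCircle.haarAddCircle := by
  have h1 : MeasurePreserving (fun u : ℝ => T⁻¹ * u)
      (ENNReal.ofReal T⁻¹ • volume.restrict (Set.Ico 0 T)) (volume.restrict (Set.Ioc 0 (0 + 1))) := by
    have hm : Measurable fun u : ℝ => T⁻¹ * u := by fun_prop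
    refine ⟨hm, ?_⟩
    have hpre : Set.Ico 0 T = (fun u : ℝ => T⁻¹ * u) ⁻¹' Set.Ico 0 1 := by
      ext u
      simp only [Set.mem_Ico, Set.mem_preimage, inv_mul_eq_div, div_lt_one hT]
      rw [le_div_iff₀ hT, zero_mul]
    rw [Measure.map_smul, hpre, ← Measure.restrict_map hm measurableSet_Ico,
      ← Measure.restrict_smul]
    have h := Real.smul_map_volume_mul_left (inv_ne_zero hT.ne')
    rw [abs_of_pos (inv_pos.mpr hT)] at h
    rw [h, zero_add]
    exact Measure.restrict_congr_set Ico_ae_eq_Ioc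
  have h2 := UnitAddCircle.measurePreserving_mk 0
  rw [AddCircle.volume_eq_smul_haarAddCircle, ENNReal.ofReal_one, one_smul] at h2
  exact h2.comp h1

/-- The Haar probability measure as the standard measure of the unit circle, as in the theory of
multidimensional Fourier series. -/
noncomputable local instance instMeasureSpaceUnitAddCircle : MeasureSpace UnitAddCircle :=
  ⟨AddCircle.haarAddCircle⟩

local instance instIsProbabilityMeasureUnitAddCircle :
    IsProbabilityMeasure (volume : Measure UnitAddCircle) :=
  inferInstanceAs (IsProbabilityMeasure AddCircle.haarAddCircle)

/-- The parametrisation of the standard two-dimensional torus by the phase space. -/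
noncomputable def toUnitTorus (d : ℕ) (Ω : ℝ × ℝ) : UnitAddTorus (Fin 2) :=
  MeasurableEquiv.finTwoArrow.symm
    ((((d * step d)⁻¹ * Ω.1 : ℝ) : UnitAddCircle), (((d * step d)⁻¹ * Ω.2 : ℝ) : UnitAddCircle))

theorem measurePreserving_toUnitTorus :
    MeasurePreserving (toUnitTorus d) (ENNReal.ofReal (2 * Real.pi)⁻¹ • torusMeasure d) volume := by
  have hL := period_pos (d := d)
  have hd : (0 : ℝ) < d := by exact_mod_cast NeZero.pos d
  have h1 := (measurePreserving_div_coe hL).prod (measurePreserving_div_coe hL)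
  have h2 := (measurePreserving_finTwoArrow (volume : Measure UnitAddCircle)).symm.comp h1
  have h3 : (ENNReal.ofReal (2 * Real.pi)⁻¹ • torusMeasure d) =
      (ENNReal.ofReal (d * step d)⁻¹ • volume.restrict (Set.Ico 0 (d * step d))).prod
      (ENNReal.ofReal (d * step d)⁻¹ • volume.restrict (Set.Ico 0 (d * step d))) := by
    rw [torusMeasure_eq_smul_prod, Measure.prod_smul_left, Measure.prod_smul_right, smul_smul,
      smul_smul, ← ENNReal.ofReal_mul (by positivity), ← ENNReal.ofReal_mul (by positivity)]
    congr 2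
    rw [← period_mul_step (NeZero.pos d)]
    field_simp
  rw [h3]
  exact h2

/-- The section of `toUnitTorus` with values in the fundamental domain. -/
noncomputable def ofUnitTorus (d : ℕ) (z : UnitAddTorus (Fin 2)) : ℝ × ℝ :=
  ((d * step d) * (AddCircle.measurableEquivIco 1 0 (z 0) : ℝ),
    (d * step d) * (AddCircle.measurableEquivIco 1 0 (z 1) : ℝ))

theorem measurable_ofUnitTorus {d : ℕ} : Measurable (ofUnitTorus d) := by
  have h : ∀ i : Fin 2, Measurable fun z : UnitAddTorus (Fin 2) =>
      (AddCircle.measurableEquivIco 1 0 (z i) : ℝ) := fun i =>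
    measurable_subtype_coe.comp
      ((AddCircle.measurableEquivIco 1 0).measurable.comp (measurable_pi_apply i))
  exact ((h 0).const_mul _).prodMk ((h 1).const_mul _)

theorem ofUnitTorus_toUnitTorus {Ω : ℝ × ℝ} (hΩ : Ω ∈ torus d) :
    ofUnitTorus d (toUnitTorus d Ω) = Ω := by
  have hL := period_pos (d := d)
  have h : ∀ u ∈ Set.Ico 0 (d * step d), (d * step d) *
      (AddCircle.measurableEquivIco 1 0 (((d * step d)⁻¹ * u : ℝ) : UnitAddCircle) : ℝ) = u := by
    intro u hu
    have hmem : (d * step d)⁻¹ * u ∈ Set.Ico (0 : ℝ) (0 + 1) := by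
      rw [inv_mul_eq_div]
      exact ⟨div_nonneg hu.1 hL.le, by rw [zero_add, div_lt_one hL]; exact hu.2⟩
    have e : (AddCircle.measurableEquivIco 1 0 (((d * step d)⁻¹ * u : ℝ) : UnitAddCircle) : ℝ) =
        (d * step d)⁻¹ * u := congrArg Subtype.val (AddCircle.equivIco_coe_eq hmem)
    rw [e, mul_inv_cancel_left₀ hL.ne']
  exact Prod.ext (h _ hΩ.1) (h _ hΩ.2)

/-- The monomials of the standard torus correspond to the harmonic functions with `(m,n) = (-n₀,n₁)`. -/
theorem mFourier_toUnitTorus (n : Fin 2 → ℤ) (Ω : ℝ × ℝ) :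
    UnitAddTorus.mFourier (-n) (toUnitTorus d Ω) =
      (√(2 * Real.pi) : ℂ) * conj (torusHarmonic d (-n 0, n 1) Ω) := by
  have h2pi : (√(2 * Real.pi) : ℂ) ≠ 0 := by
    exact_mod_cast (Real.sqrt_pos.mpr (by positivity)).ne'
  have hL : ((step d : ℝ) : ℂ) = 2 * Real.pi * (d * step d : ℝ)⁻¹ := by
    have h : step d = 2 * Real.pi * (d * step d)⁻¹ := by
      rw [← period_mul_step (NeZero.pos d), mul_right_comm, mul_inv_cancel₀ (period_pos (d := d)).ne',
        one_mul]
    exact_mod_cast congrArg (fun t : ℝ => (t : ℂ)) h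
  rw [conj_torusHarmonic, mul_inv_cancel_left₀ h2pi]
  simp only [UnitAddTorus.mFourier, ContinuousMap.coe_mk, Fin.prod_univ_two]
  have e0 : toUnitTorus d Ω 0 = (((d * step d)⁻¹ * Ω.1 : ℝ) : UnitAddCircle) := rfl
  have e1 : toUnitTorus d Ω 1 = (((d * step d)⁻¹ * Ω.2 : ℝ) : UnitAddCircle) := rfl
  rw [e0, e1, fourier_coe_apply, fourier_coe_apply, ← Complex.exp_add]
  congr 1
  rw [hL]
  simp only [Pi.neg_apply]
  push_cast
  ring

theorem ae_mem_torus {d : ℕ} : ∀ᵐ Ω ∂(torusMeasure d), Ω ∈ torus d := by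
  rw [torusMeasure]
  exact Measure.ae_smul_measure (ae_restrict_mem (measurableSet_Ico.prod measurableSet_Ico)) _

/-- Completeness of the harmonic functions, transported from the Fourier basis of the standard
torus. -/
theorem torusHarmonic_complete (F : ℝ × ℝ → ℂ) (hF : MemLp F 2 (torusMeasure d))
    (h : ∀ ν, ∫ Ω, F Ω * conj (torusHarmonic d ν Ω) ∂(torusMeasure d) = 0) :
    F =ᵐ[torusMeasure d] 0 := by
  have hFm := hF.1
  -- a Borel representative makes the composition with the section measurable
  set F' := hFm.mk F with hF'
  have hFF' : F =ᵐ[torusMeasure d] F' := hFm.ae_eq_mk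
  have hF'm : StronglyMeasurable F' := hFm.stronglyMeasurable_mk
  set G : UnitAddTorus (Fin 2) → ℂ := F' ∘ ofUnitTorus d with hG
  have hGm : StronglyMeasurable G := hF'm.comp_measurable measurable_ofUnitTorus
  have hΨ := measurePreserving_toUnitTorus (d := d)
  have hc : ENNReal.ofReal (2 * Real.pi)⁻¹ ≠ 0 := by
    rw [Ne, ENNReal.ofReal_eq_zero, not_le]; positivity
  have hGF : G ∘ toUnitTorus d =ᵐ[torusMeasure d] F := by
    filter_upwards [ae_mem_torus, hFF'] with Ω hΩ h1
    rw [h1, hG, Function.comp_apply, Function.comp_apply, ofUnitTorus_toUnitTorus hΩ]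
  have hGL : MemLp G 2 volume := by
    rw [← hΨ.map_eq, memLp_map_measure_iff hGm.aestronglyMeasurable hΨ.measurable.aemeasurable]
    exact (hF.ae_eq hGF.symm).smul_measure ENNReal.ofReal_ne_top
  have hcoeff : ∀ n, UnitAddTorus.mFourierCoeff G n = 0 := by
    intro n
    have hm : AEStronglyMeasurable (fun t => UnitAddTorus.mFourier (-n) t • G t)
        (Measure.map (toUnitTorus d) (ENNReal.ofReal (2 * Real.pi)⁻¹ • torusMeasure d)) :=
      ((UnitAddTorus.mFourier (-n)).continuous.stronglyMeasurable.smul hGm).aestronglyMeasurable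
    rw [UnitAddTorus.mFourierCoeff, ← hΨ.map_eq, integral_map hΨ.measurable.aemeasurable hm,
      integral_smul_measure]
    have e : ∫ Ω, UnitAddTorus.mFourier (-n) (toUnitTorus d Ω) • G (toUnitTorus d Ω)
        ∂(torusMeasure d) = ∫ Ω, (√(2 * Real.pi) : ℂ) *
          (F Ω * conj (torusHarmonic d (-n 0, n 1) Ω)) ∂(torusMeasure d) := by
      refine integral_congr_ae ?_
      filter_upwards [hGF] with Ω h1
      have h1' : G (toUnitTorus d Ω) = F Ω := h1
      rw [h1', mFourier_toUnitTorus, smul_eq_mul]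
      ring
    rw [e, integral_const_mul, h, mul_zero, smul_zero]
  have hzero : hGL.toLp G = 0 := by
    apply UnitAddTorus.mFourierBasis.repr.injective
    ext n
    rw [UnitAddTorus.mFourierBasis_repr, map_zero, lp.coeFn_zero, Pi.zero_apply, ← hcoeff n]
    refine integral_congr_ae ?_
    filter_upwards [hGL.coeFn_toLp] with t ht
    rw [ht]
  have hG0 : G =ᵐ[volume] 0 := by
    refine hGL.coeFn_toLp.symm.trans ?_
    rw [hzero]
    exact Lp.coeFn_zero _ _ _
  have hG1 : G ∘ toUnitTorus d =ᵐ[ENNReal.ofReal (2 * Real.pi)⁻¹ • torusMeasure d] 0 :=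
    hΨ.quasiMeasurePreserving.ae_eq_comp hG0
  have hG2 : G ∘ toUnitTorus d =ᵐ[torusMeasure d] 0 := by
    rwa [Filter.EventuallyEq, Measure.ae_ennreal_smul_measure_iff hc] at hG1
  exact hGF.symm.trans hG2

theorem isHarmonicBasis : IsHarmonicBasis d where
  periodic := torusHarmonic_periodic
  eigenfunction := laplacian_torusHarmonic
  orthonormal := torusHarmonic_orthonormal
  complete := torusHarmonic_complete

end

/-! ### The operator-valued integrals over the torus -/

open MeasureTheory

section

variable {d : ℕ} [NeZero d]

/-- A uniform summable bound for the values of a Schwartz function along a comb that moves over a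
period. -/
theorem exists_summable_bound_comb (f : 𝓢(ℝ, ℂ)) (C : ZMod d → ℂ) :
    ∃ B : ℤ → ℝ, Summable B ∧ (∀ q, 0 ≤ B q) ∧
      ∀ q : ℤ, ∀ u ∈ Set.Ico 0 (d * step d), ‖C q‖ * ‖f (q * step d + u)‖ ≤ B q := by
  obtain ⟨K, hK, hC⟩ := exists_norm_le_of_finite C
  have hl := step_pos (NeZero.pos d)
  have hf := norm_le_comb f
  have hP0 : 0 ≤ 4 * (Finset.Iic (2, 0)).sup (schwartzSeminormFamily ℂ ℝ ℂ) f :=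
    mul_nonneg (by norm_num) (apply_nonneg _ _)
  generalize 4 * (Finset.Iic (2, 0)).sup (schwartzSeminormFamily ℂ ℝ ℂ) f = P at hf hP0
  refine ⟨fun q => K * (P * (1 + d * step d) ^ 2 * ((1 + |0 + step d * q|) ^ 2)⁻¹),
    ((summable_inv_comb 0 (step d) hl.ne').mul_left _).mul_left _, fun q => by positivity,
    fun q u hu => ?_⟩
  refine mul_le_mul (hC q) ?_ (norm_nonneg _) hK
  refine (hf _).trans ?_
  rw [mul_assoc]
  refine mul_le_mul_of_nonneg_left ?_ hP0
  rw [← div_eq_mul_inv, le_div_iff₀ (by positivity), inv_mul_le_iff₀ (by positivity), ← mul_pow]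
  have h1 : |0 + step d * q| ≤ |q * step d + u| + u := by
    have := abs_sub (q * step d + u) u
    rw [add_sub_cancel_right, abs_of_nonneg hu.1] at this
    rwa [zero_add, mul_comm]
  refine pow_le_pow_left₀ (by positivity) ?_ 2
  have := hu.1
  have := hu.2
  nlinarith [abs_nonneg (q * step d + u)]

/-- The factor depending on the position coordinate in the double series of the integrand. -/
noncomputable def tensorFactor (C : ZMod d → ℂ) (m : ℤ) (f g : 𝓢(ℝ, ℂ)) (p : ℤ × ℤ) (u : ℝ) : ℂ :=
  Complex.exp (Complex.I * step d * (-m : ℤ) * u) * ((C p.1 * conj (f (p.1 * step d + u))) *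
    (conj (C p.2) * g (p.2 * step d + u)))

/-- The terms of the double series of the integrand. -/
noncomputable def tensorTerm (C : ZMod d → ℂ) (ν : ℤ × ℤ) (f g : 𝓢(ℝ, ℂ)) (p : ℤ × ℤ)
    (Ω : ℝ × ℝ) : ℂ :=
  tensorFactor C ν.1 f g p Ω.1 * Complex.exp (Complex.I * step d * (ν.2 + p.1 - p.2 : ℤ) * Ω.2)

theorem norm_exp_I_step_mul {d : ℕ} (k : ℤ) (t : ℝ) :
    ‖Complex.exp (Complex.I * step d * k * t)‖ = 1 := by
  rw [← norm_exp_I_mul (step d * k * t)]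
  congr 2
  push_cast
  ring

theorem norm_tensorTerm {d : ℕ} (C : ZMod d → ℂ) (ν : ℤ × ℤ) (f g : 𝓢(ℝ, ℂ)) (p : ℤ × ℤ) (Ω : ℝ × ℝ) :
    ‖tensorTerm C ν f g p Ω‖ = (‖C p.1‖ * ‖f (p.1 * step d + Ω.1)‖) *
      (‖C p.2‖ * ‖g (p.2 * step d + Ω.1)‖) := by
  rw [tensorTerm, tensorFactor]
  simp only [norm_mul, norm_exp_I_step_mul, RCLike.norm_conj]
  ring

theorem continuous_tensorTerm {d : ℕ} (C : ZMod d → ℂ) (ν : ℤ × ℤ) (f g : 𝓢(ℝ, ℂ)) (p : ℤ × ℤ) :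
    Continuous (tensorTerm C ν f g p) := by
  unfold tensorTerm tensorFactor
  have hf := f.continuous
  have hg := g.continuous
  have hc := Complex.continuous_conj
  have h1 : Continuous fun Ω : ℝ × ℝ => conj (f (p.1 * step d + Ω.1)) :=
    hc.comp (hf.comp (by fun_prop))
  have h2 : Continuous fun Ω : ℝ × ℝ => g (p.2 * step d + Ω.1) := hg.comp (by fun_prop)
  fun_prop

theorem summable_norm_dispKet (C : ZMod d → ℂ) (x p : ℝ) (f : 𝓢(ℝ, ℂ)) :
    Summable fun q : ℤ => ‖C q * (Complex.exp (Complex.I * (p * (q * step d) : ℝ)) *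
      conj (f (q * step d + x)))‖ := by
  obtain ⟨K, hK, hC⟩ := exists_norm_le_of_finite C
  have h := (summable_comb x (step d) (step_pos (NeZero.pos d)).ne' f).norm.mul_left K
  refine Summable.of_nonneg_of_le (fun _ => norm_nonneg _) (fun q => ?_) h
  rw [norm_mul, norm_mul, norm_exp_I_mul, one_mul, add_comm, mul_comm (q : ℝ)]
  exact mul_le_mul_of_nonneg_right (hC _) (norm_nonneg _)

theorem tensorIntegrand_codeKet (C : ZMod d → ℂ) (ν : ℤ × ℤ) (f g : 𝓢(ℝ, ℂ)) (Ω : ℝ × ℝ) :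
    tensorIntegrand d (codeKet d C) ν f g Ω =
      ((√(2 * Real.pi))⁻¹ : ℂ) * (step d : ℂ)⁻¹ * ∑' p, tensorTerm C ν f g p Ω := by
  have hs : ((√(step d))⁻¹ : ℂ) * ((√(step d))⁻¹ : ℂ) = (step d : ℂ)⁻¹ := by
    rw [← mul_inv, ← Complex.ofReal_mul, Real.mul_self_sqrt (step_pos (NeZero.pos d)).le]
  have hE : Complex.exp (Complex.I * (Ω.1 * Ω.2 / 2 : ℝ)) *
      conj (Complex.exp (Complex.I * (Ω.1 * Ω.2 / 2 : ℝ))) = 1 := by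
    rw [Complex.mul_conj, Complex.normSq_eq_norm_sq, norm_exp_I_mul]; simp
  have hprod := tsum_mul_tsum_of_summable_norm (summable_norm_dispKet C Ω.1 Ω.2 f)
    (g := fun r : ℤ => conj (C r * (Complex.exp (Complex.I * (Ω.2 * (r * step d) : ℝ)) *
      conj (g (r * step d + Ω.1))))) (by
        simpa only [RCLike.norm_conj] using summable_norm_dispKet C Ω.1 Ω.2 g)
  have hterm : ∀ p, tensorTerm C ν f g p Ω =
      Complex.exp (Complex.I * step d * (ν.2 * Ω.2 - ν.1 * Ω.1)) *
      ((C p.1 * (Complex.exp (Complex.I * (Ω.2 * (p.1 * step d) : ℝ)) *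
        conj (f (p.1 * step d + Ω.1)))) *
      conj (C p.2 * (Complex.exp (Complex.I * (Ω.2 * (p.2 * step d) : ℝ)) *
        conj (g (p.2 * step d + Ω.1))))) := by
    intro p
    have e : Complex.exp (Complex.I * step d * (-ν.1 : ℤ) * Ω.1) *
        Complex.exp (Complex.I * step d * (ν.2 + p.1 - p.2 : ℤ) * Ω.2) =
        Complex.exp (Complex.I * step d * (ν.2 * Ω.2 - ν.1 * Ω.1)) *
        (Complex.exp (Complex.I * (Ω.2 * (p.1 * step d) : ℝ)) *
        Complex.exp (-Complex.I * (Ω.2 * (p.2 * step d) : ℝ))) := by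
      rw [← Complex.exp_add, ← Complex.exp_add, ← Complex.exp_add]
      congr 1
      push_cast
      ring
    simp only [tensorTerm, tensorFactor, map_mul, Complex.conj_conj, ← Complex.exp_conj,
      Complex.conj_I, Complex.conj_ofReal]
    linear_combination (C p.1 * conj (f (p.1 * step d + Ω.1)) *
      (conj (C p.2) * g (p.2 * step d + Ω.1))) * e
  simp only [hterm]
  rw [tsum_mul_left, ← hprod, tensorIntegrand, coherent, dispKet_codeKet_apply,
    dispKet_codeKet_apply, torusHarmonic, ← hs]
  simp only [map_mul, map_inv₀, Complex.conj_ofReal, Complex.conj_tsum]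
  linear_combination (((√(2 * Real.pi))⁻¹ : ℂ) *
    Complex.exp (Complex.I * step d * (ν.2 * Ω.2 - ν.1 * Ω.1)) *
    (((√(step d))⁻¹ : ℂ) * ((√(step d))⁻¹ : ℂ)) *
    (∑' q : ℤ, C q * (Complex.exp (Complex.I * (Ω.2 * (q * step d) : ℝ)) *
          conj (f (q * step d + Ω.1)))) *
    (∑' q : ℤ, conj (C q) * (conj (Complex.exp (Complex.I * (Ω.2 * (q * step d) : ℝ))) *
          conj (conj (g (q * step d + Ω.1)))))) * hE

theorem exists_summable_bound_tensorTerm (C : ZMod d → ℂ) (ν : ℤ × ℤ) (f g : 𝓢(ℝ, ℂ)) :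
    ∃ B : ℤ × ℤ → ℝ, Summable B ∧ ∀ p, ∀ Ω ∈ torus d, ‖tensorTerm C ν f g p Ω‖ ≤ B p := by
  obtain ⟨A, hA, hA0, hAb⟩ := exists_summable_bound_comb f C
  obtain ⟨B, hB, hB0, hBb⟩ := exists_summable_bound_comb g C
  refine ⟨fun p => A p.1 * B p.2, hA.mul_of_nonneg hB hA0 hB0, fun p Ω hΩ => ?_⟩
  rw [norm_tensorTerm]
  exact mul_le_mul (hAb _ _ hΩ.1) (hBb _ _ hΩ.1) (by positivity) (hA0 _)

theorem integrable_of_continuousOn_torus {d : ℕ} {F : ℝ × ℝ → ℂ} (hF : ContinuousOn F (torus d)) {B : ℝ}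
    (hB : ∀ Ω ∈ torus d, ‖F Ω‖ ≤ B) : Integrable F (torusMeasure d) := by
  refine Integrable.of_bound (C := B) ?_ ?_
  · rw [torusMeasure]
    exact (hF.aestronglyMeasurable (measurableSet_Ico.prod measurableSet_Ico)).smul_measure _
  · filter_upwards [ae_mem_torus] with Ω hΩ using hB Ω hΩ

theorem integrable_tensorIntegrand (C : ZMod d → ℂ) (ν : ℤ × ℤ) (f g : 𝓢(ℝ, ℂ)) :
    Integrable (tensorIntegrand d (codeKet d C) ν f g) (torusMeasure d) := by
  obtain ⟨B, hB, hb⟩ := exists_summable_bound_tensorTerm C ν f g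
  have h : Integrable (fun Ω => ∑' p, tensorTerm C ν f g p Ω) (torusMeasure d) :=
    integrable_of_continuousOn_torus
      (continuousOn_tsum (fun p => (continuous_tensorTerm C ν f g p).continuousOn) hB hb)
      fun Ω hΩ => tsum_of_norm_bounded hB.hasSum fun p => hb p Ω hΩ
  exact (h.const_mul _).congr (Filter.Eventually.of_forall fun Ω =>
    (tensorIntegrand_codeKet C ν f g Ω).symm)

theorem integral_tensorTerm (C : ZMod d → ℂ) (ν : ℤ × ℤ) (f g : 𝓢(ℝ, ℂ)) (p : ℤ × ℤ) :
    ∫ Ω, tensorTerm C ν f g p Ω ∂(torusMeasure d) =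
      if p.2 = p.1 + ν.2 then step d * ∫ u in Set.Ico 0 (d * step d), tensorFactor C ν.1 f g p u
      else 0 := by
  have h := integral_torusMeasure_mul (d := d) (tensorFactor C ν.1 f g p)
    (fun v => Complex.exp (Complex.I * step d * (ν.2 + p.1 - p.2 : ℤ) * v))
  have hd : (d : ℂ) ≠ 0 := by exact_mod_cast (NeZero.ne d)
  rw [integral_exp_Ico] at h
  refine h.trans ?_
  by_cases hp : p.2 = p.1 + ν.2
  · rw [if_pos hp, if_pos (by omega)]
    push_cast
    field_simp
  · rw [if_neg hp, if_neg (by omega), mul_zero, mul_zero]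

/-- Termwise integration of the double series, of which the integral over `v` retains the terms
`(q, q + n)`. -/
theorem hasSum_integral_tensorFactor (C : ZMod d → ℂ) (ν : ℤ × ℤ) (f g : 𝓢(ℝ, ℂ)) :
    HasSum (fun q : ℤ => step d *
        ∫ u in Set.Ico 0 (d * step d), tensorFactor C ν.1 f g (q, q + ν.2) u)
      (∫ Ω, ∑' p, tensorTerm C ν f g p Ω ∂(torusMeasure d)) := by
  obtain ⟨B, hB, hb⟩ := exists_summable_bound_tensorTerm C ν f g
  have hint : ∀ p, Integrable (tensorTerm C ν f g p) (torusMeasure d) := fun p =>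
    integrable_of_continuousOn_torus (continuous_tensorTerm C ν f g p).continuousOn (hb p)
  have hsum : Summable fun p => ∫ Ω, ‖tensorTerm C ν f g p Ω‖ ∂(torusMeasure d) := by
    refine Summable.of_nonneg_of_le (fun p => integral_nonneg fun _ => norm_nonneg _) (fun p => ?_)
      (hB.mul_left ((torusMeasure d).real Set.univ))
    rw [← smul_eq_mul, ← integral_const]
    refine integral_mono_ae (hint p).norm (integrable_const _) ?_
    filter_upwards [ae_mem_torus] with Ω hΩ using hb p Ω hΩ
  have h := hasSum_integral_of_summable_integral_norm hint hsum
  have hinj : Function.Injective fun q : ℤ => (q, q + ν.2) := fun q q' h => congrArg Prod.fst h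
  refine ((hinj.hasSum_iff ?_).mpr h).congr_fun ?_
  · intro p hp
    rw [integral_tensorTerm, if_neg]
    intro h
    exact hp ⟨p.1, Prod.ext rfl h.symm⟩
  · intro q
    simp [integral_tensorTerm]

/-- Unfolding an integral over the line along a comb. -/
theorem tsum_integral_Ico {H : ℝ → ℂ} (hH : Integrable H) {T : ℝ} (hT : 0 < T) (a : ℝ) :
    ∑' n : ℤ, ∫ u in Set.Ico 0 T, H (a + n * T + u) = ∫ y, H y := by
  have h1 : ∀ n : ℤ, ∫ u in Set.Ico 0 T, H (a + n * T + u) =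
      ∫ y in Set.Ico (a + n • T) (a + (n + 1) • T), H y := by
    intro n
    rw [← (measurePreserving_add_left (volume : Measure ℝ) (a + n * T)).setIntegral_preimage_emb
      (measurableEmbedding_addLeft _) H, Set.preimage_const_add_Ico]
    congr 2
    simp only [zsmul_eq_mul, Int.cast_add, Int.cast_one]
    congr 1 <;> ring
  simp only [h1]
  have hU := iUnion_Ico_add_zsmul hT a
  rw [← integral_iUnion (fun n => measurableSet_Ico) (Set.pairwise_disjoint_Ico_add_zsmul a T)
    (by rw [hU]; exact hH.integrableOn), hU, Measure.restrict_univ]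

/-- `∫ dμ(Ω) Y_{mn}(Ω) |Ω⟩⟨Ω| = (2π)^(-1/2) ⟨ψ|D(nℓ,mℓ)ψ⟩ D(nℓ,mℓ)†`: only the scalar depends on the
reference ket. -/
theorem integral_tensorIntegrand (C : ZMod d → ℂ) (ν : ℤ × ℤ) (f g : 𝓢(ℝ, ℂ)) :
    ∫ Ω, tensorIntegrand d (codeKet d C) ν f g Ω ∂(torusMeasure d) =
      ((√(2 * Real.pi))⁻¹ : ℂ) * codeInner d (codeKet d C)
        (dispKet (ν.2 * step d) (ν.1 * step d) (codeKet d C)) *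
        braket f (displacement (-(ν.2 * step d)) (-(ν.1 * step d)) g) := by
  obtain ⟨m, n⟩ := ν
  have hl : (step d : ℂ) ≠ 0 := by exact_mod_cast (step_pos (NeZero.pos d)).ne'
  set D := braket f (displacement (-(n * step d)) (-(m * step d)) g) with hD
  set E := Complex.exp (Complex.I * ((n * step d) * (m * step d) / 2 : ℝ)) with hE
  let H : ℝ → ℂ := fun y => E * (conj (f y) * displacement (-(n * step d)) (-(m * step d)) g y)
  have hH : Integrable H := (integrable_conj_mul f _).const_mul E
  have hHint : ∫ y, H y = E * D := integral_const_mul _ _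
  have hfac : ∀ (q : ℤ) (u : ℝ), tensorFactor C m f g (q, q + n) u =
      C q * conj (C (q + n : ℤ)) * ZMod.stdAddChar ((m * q : ℤ) : ZMod d) *
        H (q * step d + u) := by
    intro q u
    have e1 : q * step d + u - -(n * step d) = ((q + n : ℤ) : ℝ) * step d + u := by
      push_cast; ring
    simp only [tensorFactor, H, hE, displacement_apply]
    rw [e1, ← exp_eq_stdAddChar]
    have e2 : Complex.exp (Complex.I * step d * (-m : ℤ) * u) =
        Complex.exp (Complex.I * (step d * step d * ((m * q : ℤ) : ℝ) : ℝ)) *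
        (Complex.exp (Complex.I * ((n * step d) * (m * step d) / 2 : ℝ)) *
        (Complex.exp (-(Complex.I * (-(n * step d) : ℝ) * (-(m * step d) : ℝ) / 2)) *
        Complex.exp (Complex.I * (-(m * step d) : ℝ) * (q * step d + u : ℝ)))) := by
      rw [← Complex.exp_add, ← Complex.exp_add, ← Complex.exp_add]
      congr 1
      push_cast
      ring
    rw [e2]
    ring
  have hsum := hasSum_integral_tensorFactor C (m, n) f g
  simp only [tensorIntegrand_codeKet]
  rw [integral_const_mul, ← hsum.tsum_eq, tsum_int_eq_sum_tsum (d := d) hsum.summable,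
    codeInner_dispKet, ← hE]
  have hj : ∀ j : Fin d, ∑' k : ℤ, step d * ∫ u in Set.Ico 0 (d * step d),
      tensorFactor C m f g ((j : ℤ) + d * k, (j : ℤ) + d * k + n) u =
      step d * (E * D) * (conj (C (finEquivZMod d j + n)) *
        (ZMod.stdAddChar ((m : ZMod d) * finEquivZMod d j) * C (finEquivZMod d j))) := by
    intro j
    have hk : ∀ k : ℤ, step d * ∫ u in Set.Ico 0 (d * step d),
        tensorFactor C m f g ((j : ℤ) + d * k, (j : ℤ) + d * k + n) u =
        step d * (conj (C (finEquivZMod d j + n)) *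
          (ZMod.stdAddChar ((m : ZMod d) * finEquivZMod d j) * C (finEquivZMod d j))) *
          ∫ u in Set.Ico 0 (d * step d), H (j * step d + k * (d * step d) + u) := by
      intro k
      simp only [hfac]
      rw [integral_const_mul, finEquivZMod_apply]
      have e : ∀ u, (((j : ℤ) + d * k : ℤ) : ℝ) * step d + u = j * step d + k * (d * step d) + u :=
        fun u => by push_cast; ring
      simp only [e]
      push_cast
      rw [ZMod.natCast_self, zero_mul, add_zero]
      ring
    simp only [hk]
    rw [tsum_mul_left, tsum_integral_Ico hH period_pos, hHint]
    ring
  simp only [hj]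
  rw [← Finset.mul_sum, (finEquivZMod d).sum_comp fun z => conj (C (z + n)) *
    (ZMod.stdAddChar ((m : ZMod d) * z) * C z), ← ambiguity]
  field_simp

end

/-! ### Reference kets, the phase space and the overlap coefficients -/

section

variable {d : ℕ} [NeZero d]

/-- The isotropy group of the zero ket is the whole group, so the isotropy condition excludes it. -/
theorem ne_zero_of_isotropy_eq {ψ : Ket} (h : isotropy ψ = gkpSymmetry d) : ψ ≠ 0 := by
  rintro rfl
  have hL := period_pos (d := d)
  -- half a period is not a multiple of the period
  have hmem : (⟨0, d * step d / 2, 0⟩ : Heis) ∈ isotropy (0 : Ket) :=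
    ⟨1, norm_one, by ext f; simp [rep, dispKet_apply]⟩
  rw [h] at hmem
  obtain ⟨k, -, hk, -⟩ := hmem
  have h2 : (2 * k : ℝ) = 1 := by
    refine mul_right_cancel₀ hL.ne' ?_
    simp only at hk
    linarith
  have h3 : 2 * k = 1 := by exact_mod_cast h2
  omega

/-- Points of the phase space are classes of group elements with equal `x` and `p` modulo the period,
the phase being irrelevant. -/
theorem mk_eq_mk_iff {d : ℕ} {ψ : Ket} (h : isotropy ψ = gkpSymmetry d) (g g' : Heis) :
    (QuotientGroup.mk g : Heis ⧸ isotropy ψ) = QuotientGroup.mk g' ↔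
      ∃ k l : ℤ, g'.x = g.x + k * (d * step d) ∧ g'.p = g.p + l * (d * step d) := by
  rw [QuotientGroup.eq, h]
  constructor
  · rintro ⟨k, l, hx, hp⟩
    simp only [Heis.mul_def, Heis.inv_def] at hx hp
    exact ⟨k, l, by linarith, by linarith⟩
  · rintro ⟨k, l, hx, hp⟩
    refine ⟨k, l, ?_, ?_⟩
    · simp only [Heis.mul_def, Heis.inv_def]; linarith
    · simp only [Heis.mul_def, Heis.inv_def]; linarith

theorem bijective_torusToPhaseSpace {ψ : Ket} (h : isotropy ψ = gkpSymmetry d) :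
    Function.Bijective (torusToPhaseSpace d ψ) := by
  have hL := period_pos (d := d)
  constructor
  · rintro ⟨⟨u, v⟩, hu, hv⟩ ⟨⟨u', v'⟩, hu', hv'⟩ e
    obtain ⟨k, l, hk, hl⟩ := (mk_eq_mk_iff h _ _).mp e
    simp only at hk hl hu hv hu' hv'
    have e1 : u = u' := by
      have := (toIcoMod_eq_self hL (b := u) (a := 0)).mpr (by simpa using hu)
      have h2 := (toIcoMod_eq_self hL (b := u') (a := 0)).mpr (by simpa using hu')
      rw [hk, ← zsmul_eq_mul, toIcoMod_add_zsmul, this, zsmul_eq_mul, ← hk] at h2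
      exact h2
    have e2 : v = v' := by
      have := (toIcoMod_eq_self hL (b := v) (a := 0)).mpr (by simpa using hv)
      have h2 := (toIcoMod_eq_self hL (b := v') (a := 0)).mpr (by simpa using hv')
      rw [hl, ← zsmul_eq_mul, toIcoMod_add_zsmul, this, zsmul_eq_mul, ← hl] at h2
      exact h2
    subst e1 e2
    rfl
  · intro q
    obtain ⟨g, rfl⟩ := QuotientGroup.mk_surjective q
    refine ⟨⟨(toIcoMod hL 0 g.x, toIcoMod hL 0 g.p), ?_, ?_⟩, (mk_eq_mk_iff h _ _).mpr
      ⟨toIcoDiv hL 0 g.x, toIcoDiv hL 0 g.p, ?_, ?_⟩⟩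
    · simpa using toIcoMod_mem_Ico hL 0 g.x
    · simpa using toIcoMod_mem_Ico hL 0 g.p
    · rw [← zsmul_eq_mul]; exact (toIcoMod_add_toIcoDiv_zsmul hL 0 g.x).symm
    · rw [← zsmul_eq_mul]; exact (toIcoMod_add_toIcoDiv_zsmul hL 0 g.p).symm

theorem torusHarmonic_ne_zero {d : ℕ} (ν : ℤ × ℤ) (Ω : ℝ × ℝ) : torusHarmonic d ν Ω ≠ 0 := by
  rw [← norm_pos_iff, norm_torusHarmonic]
  have := Real.pi_pos
  positivity

/-- The coefficients of the overlap expansion are the squared overlaps of the reference ket with its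
displacements by multiples of `ℓ`. -/
theorem isOverlapExpansion_iff {C : ZMod d → ℂ} (h0 : codeKet d C ≠ 0) (τ : ℤ × ℤ → ℝ) :
    IsOverlapExpansion d (codeKet d C) τ ↔ ∀ κ, τ κ = ‖ambiguity C κ.2 κ.1‖ ^ 2 := by
  have hsum : ∀ (Ω : ℝ × ℝ) (κ : ℤ × ℤ), HasSum (fun ν : ℤ × ℤ =>
      (τ ν : ℂ) * conj (torusHarmonic d ν Ω) *
        ∫ Ω', torusHarmonic d ν Ω' * conj (torusHarmonic d κ Ω') ∂(torusMeasure d))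
      ((τ κ : ℂ) * conj (torusHarmonic d κ Ω)) := by
    intro Ω κ
    simp only [torusHarmonic_orthonormal, mul_ite, mul_one, mul_zero]
    convert hasSum_ite_eq κ ((τ κ : ℂ) * conj (torusHarmonic d κ Ω)) using 2 with ν
    split_ifs with h
    · rw [h]
    · rfl
  constructor
  · intro h κ
    have hmem : ((0, 0) : ℝ × ℝ) ∈ torus d :=
      ⟨⟨le_rfl, period_pos⟩, ⟨le_rfl, period_pos⟩⟩
    have e := (hsum (0, 0) κ).unique (h (0, 0) hmem κ)
    rw [overlapPairing_codeKet h0] at e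
    have hne : conj (torusHarmonic d κ (0, 0)) ≠ 0 :=
      (map_ne_zero _).mpr (torusHarmonic_ne_zero κ _)
    exact_mod_cast mul_right_cancel₀ hne e
  · intro h Ω _ κ
    rw [overlapPairing_codeKet h0, ← h]
    exact hsum Ω κ

theorem existsUnique_isOverlapExpansion {ψ : Ket} (hψ : ψ ∈ codeSpace d) (h0 : ψ ≠ 0) :
    ∃! τ : ℤ × ℤ → ℝ, IsOverlapExpansion d ψ τ := by
  obtain ⟨C, rfl⟩ := exists_eq_codeKet hψ
  refine ⟨fun κ => ‖ambiguity C κ.2 κ.1‖ ^ 2, (isOverlapExpansion_iff h0 _).mpr fun κ => rfl, ?_⟩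
  intro τ hτ
  exact funext ((isOverlapExpansion_iff h0 τ).mp hτ)

theorem IsReference.coeff_eq {ψ : Ket} {τ : ℤ × ℤ → ℝ} (h : IsReference d ψ τ) (ν : ℤ × ℤ) :
    τ ν = ‖codeInner d ψ (dispKet (ν.2 * step d) (ν.1 * step d) ψ)‖ ^ 2 := by
  have h0 := ne_zero_of_isotropy_eq h.isotropy_eq
  have he := h.expansion
  obtain ⟨C, rfl⟩ := exists_eq_codeKet h.mem_code
  rw [norm_codeInner_dispKet]
  exact (isOverlapExpansion_iff h0 τ).mp he ν

theorem IsReference.coeff_pos {ψ : Ket} {τ : ℤ × ℤ → ℝ} (h : IsReference d ψ τ) (ν : ℤ × ℤ) :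
    0 < τ ν :=
  lt_of_le_of_ne (by rw [h.coeff_eq]; positivity) (h.ne_zero ν).symm

/-! ### The constructed kernel -/

theorem conj_braket_displacement (x p : ℝ) (f g : 𝓢(ℝ, ℂ)) :
    conj (braket g (displacement (-x) (-p) f)) = braket f (displacement x p g) := by
  rw [conj_braket, braket_displacement]

/-- If the phase of the tensor operator is that of a multiple `s = ±1` of the expectation value of
`D(nℓ,mℓ)`, then the tensor operator is a multiple of `s D(nℓ,mℓ)†`. -/
theorem IsReference.tensorOpAdj_eq {ψ : Ket} {τ : ℤ × ℤ → ℝ} (h : IsReference d ψ τ)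
    {φ : ℤ × ℤ → ℝ} {ν : ℤ × ℤ} {s : ℝ} (hs : s * s = 1)
    (hφ : φ ν = ((s : ℂ) * codeInner d ψ (dispKet (ν.2 * step d) (ν.1 * step d) ψ)).arg)
    (f g : 𝓢(ℝ, ℂ)) :
    tensorOpAdj d ψ τ φ ν f g = ((√(2 * Real.pi))⁻¹ : ℂ) *
      (s * braket f (displacement (ν.2 * step d) (ν.1 * step d) g)) := by
  have hτ := h.coeff_eq ν
  have hτ0 := h.ne_zero ν
  obtain ⟨C, rfl⟩ := exists_eq_codeKet h.mem_code
  rw [tensorOpAdj, tensorOp, integral_tensorIntegrand]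
  set z := codeInner d (codeKet d C) (dispKet (ν.2 * step d) (ν.1 * step d) (codeKet d C)) with hz
  have hz0 : z ≠ 0 := by
    intro h0
    rw [hτ, h0] at hτ0
    simp at hτ0
  have hs1 : |s| = 1 := by
    have : |s| * |s| = 1 := by rw [abs_mul_abs_self, hs]
    nlinarith [abs_nonneg s]
  have hsz : ‖(s : ℂ) * z‖ = √(τ ν) := by
    rw [hτ, Real.sqrt_sq (norm_nonneg _), norm_mul, Complex.norm_real, Real.norm_eq_abs, hs1,
      one_mul]
  -- the prefactor `exp (i φ) √τ` is the polar form of `s ⟨ψ|D(nℓ,mℓ)ψ⟩`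
  have hpol : Complex.exp (Complex.I * φ ν) * (√(τ ν) : ℂ) = s * z := by
    rw [hφ, ← hsz, mul_comm, mul_comm Complex.I]
    exact Complex.norm_mul_exp_arg_mul_I _
  rw [hpol]
  have hsc : (s : ℂ) * s = 1 := by exact_mod_cast hs
  have hs0 : (s : ℂ) ≠ 0 := left_ne_zero_of_mul_eq_one hsc
  have e : ((s : ℂ) * z)⁻¹ * (((√(2 * Real.pi))⁻¹ : ℂ) * z *
      braket g (displacement (-(ν.2 * step d)) (-(ν.1 * step d)) f)) =
      ((√(2 * Real.pi))⁻¹ : ℂ) * (s * braket g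
        (displacement (-(ν.2 * step d)) (-(ν.1 * step d)) f)) := by
    have hinv : (s : ℂ)⁻¹ = s := inv_eq_of_mul_eq_one_left hsc
    rw [mul_inv, hinv]
    field_simp
  rw [e, map_mul, map_mul, conj_braket_displacement]
  simp only [map_inv₀, Complex.conj_ofReal]

/-- For odd `d` the encoded displacements are the displacements up to the sign `(-1)^(ab)`. -/
theorem logicalDisp_eq (hd : Odd d) (a b : ℤ) (ψ : Ket) :
    logicalDisp d a b ψ = ((-1) ^ (a * b) : ℂ) • dispKet (a * step d) (b * step d) ψ := by
  rw [logicalDisp, dispKet_dispKet, smul_smul, add_zero, zero_add]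
  congr 1
  obtain ⟨k, hk⟩ := hd
  have hd0 : (d : ℂ) ≠ 0 := by exact_mod_cast (NeZero.ne d)
  -- the division is exact because `d` is odd
  have hk2 : (d + 1) / 2 = k + 1 := by omega
  have hl : (step d : ℂ) * step d = 2 * Real.pi / d := by
    exact_mod_cast congrArg (fun t : ℝ => (t : ℂ)) (step_sq (NeZero.pos d))
  have hdk : (d : ℂ) = 2 * k + 1 := by rw [hk]; push_cast; ring
  rw [hk2, ← Complex.exp_int_mul, ← Complex.exp_pi_mul_I, ← Complex.exp_int_mul, ← Complex.exp_add]
  congr 1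
  push_cast
  have e : Complex.I * ((0 * 0 - (a * step d : ℂ) * (b * step d)) / 2) =
      -(Complex.I * a * b * (Real.pi / d)) := by
    linear_combination (-(Complex.I * a * b) / 2) * hl
  rw [e]
  field_simp
  rw [hdk]
  ring

theorem codeInner_smul {ψ χ : Ket} (hψ : ψ ∈ codeSpace d) (hχ : χ ∈ codeSpace d) (c : ℂ) :
    codeInner d ψ (c • χ) = c * codeInner d ψ χ := by
  obtain ⟨C, rfl⟩ := exists_eq_codeKet hψ
  obtain ⟨C', rfl⟩ := exists_eq_codeKet hχ
  rw [← codeKet_smul, codeInner_codeKet, codeInner_codeKet, Finset.mul_sum]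
  refine Finset.sum_congr rfl fun z _ => ?_
  simp only [Pi.smul_apply, smul_eq_mul]
  ring

theorem dispKet_mem_codeSpace {ψ : Ket} (hψ : ψ ∈ codeSpace d) (n m : ℤ) :
    dispKet (n * step d) (m * step d) ψ ∈ codeSpace d := by
  obtain ⟨C, rfl⟩ := exists_eq_codeKet hψ
  rw [dispKet_codeKet]
  exact Submodule.smul_mem _ _ (codeKet_mem _)

theorem IsReference.tensorOpAdj_logicalPhase (hd : Odd d) {ψ : Ket} {τ : ℤ × ℤ → ℝ}
    (h : IsReference d ψ τ) (ν : ℤ × ℤ) (f g : 𝓢(ℝ, ℂ)) :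
    tensorOpAdj d ψ τ (logicalPhase d ψ) ν f g =
      ((√(2 * Real.pi))⁻¹ : ℂ) * zakGrossTerm d f g ν := by
  have hs : ((-1 : ℝ) ^ (ν.1 * ν.2)) * ((-1 : ℝ) ^ (ν.1 * ν.2)) = 1 := by
    rw [← mul_zpow]; simp
  rw [h.tensorOpAdj_eq hs, zakGrossTerm]
  · push_cast; rfl
  · rw [logicalPhase, logicalDisp_eq hd, codeInner_smul h.mem_code
      (dispKet_mem_codeSpace h.mem_code _ _), mul_comm ν.2]
    push_cast
    rfl

theorem IsReference.tensorOpAdj_displacementPhase {ψ : Ket} {τ : ℤ × ℤ → ℝ}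
    (h : IsReference d ψ τ) (ν : ℤ × ℤ) (f g : 𝓢(ℝ, ℂ)) :
    tensorOpAdj d ψ τ (displacementPhase d ψ) ν f g = ((√(2 * Real.pi))⁻¹ : ℂ) *
      braket f (displacement (ν.2 * step d) (ν.1 * step d) g) := by
  rw [h.tensorOpAdj_eq (s := 1) (one_mul 1)]
  · rw [Complex.ofReal_one, one_mul]
  · rw [displacementPhase, Complex.ofReal_one, one_mul]

theorem IsReference.integrable_tensorIntegrand {ψ : Ket} {τ : ℤ × ℤ → ℝ}
    (h : IsReference d ψ τ) (ν : ℤ × ℤ) (f g : 𝓢(ℝ, ℂ)) :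
    MeasureTheory.Integrable (tensorIntegrand d ψ ν f g) (torusMeasure d) := by
  obtain ⟨C, rfl⟩ := exists_eq_codeKet h.mem_code
  exact ZakGross.integrable_tensorIntegrand C ν f g

theorem IsReference.summable_kernel (hd : Odd d) {ψ : Ket} {τ : ℤ × ℤ → ℝ}
    (h : IsReference d ψ τ) (Ω : ℝ × ℝ) (f g : 𝓢(ℝ, ℂ)) :
    Summable fun ν : ℤ × ℤ =>
      torusHarmonic d ν Ω * tensorOpAdj d ψ τ (logicalPhase d ψ) ν f g := by
  refine Summable.of_norm_bounded (((summable_zakGrossTerm (NeZero.pos d) f g).norm.mul_left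
    (√(2 * Real.pi))⁻¹).mul_left (√(2 * Real.pi))⁻¹) fun ν => ?_
  rw [h.tensorOpAdj_logicalPhase hd, norm_mul, norm_torusHarmonic, norm_mul, norm_inv,
    Complex.norm_real, Real.norm_of_nonneg (Real.sqrt_nonneg _)]

theorem IsReference.constructedKernel_logicalPhase (hd : Odd d) {ψ : Ket} {τ : ℤ × ℤ → ℝ}
    (h : IsReference d ψ τ) (Ω : ℝ × ℝ) (f g : 𝓢(ℝ, ℂ)) :
    constructedKernel d ψ τ (logicalPhase d ψ) Ω f g = zakGrossKernel d Ω f g := by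
  rw [constructedKernel, zakGrossKernel_eq_tsum]
  simp only [h.tensorOpAdj_logicalPhase hd]

theorem IsReference.constructedKernel_displacementPhase {ψ : Ket} {τ : ℤ × ℤ → ℝ}
    (h : IsReference d ψ τ) (Ω : ℝ × ℝ) (f g : 𝓢(ℝ, ℂ)) :
    constructedKernel d ψ τ (displacementPhase d ψ) Ω f g =
      1 / (2 * Real.pi) * ∑' ν : ℤ × ℤ,
        Complex.exp (Complex.I * step d * (ν.2 * Ω.2 - ν.1 * Ω.1)) *
          braket f (displacement (ν.2 * step d) (ν.1 * step d) g) := by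
  rw [constructedKernel, ← tsum_mul_left]
  congr 1
  funext ν
  rw [h.tensorOpAdj_displacementPhase, torusHarmonic, ← inv_sqrt_mul_inv_sqrt]
  ring

end

end ZakGross

theorem mainTheorem7 (d : ℕ) (hd : Odd d) :
    -- the measure and the harmonic functions of the phase space
    IsInvariantMeasure d ∧ IsHarmonicBasis d ∧
    -- the series defining the Zak-Gross kernel converges
    (∀ f g : 𝓢(ℝ, ℂ), Summable (zakGrossTerm d f g)) ∧
    -- the phase space is the torus, and the overlap coefficients exist and are unique
    (∀ ψ ∈ codeSpace d, isotropy ψ = gkpSymmetry d →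
      Function.Bijective (torusToPhaseSpace d ψ) ∧
      ∃! τ : ℤ × ℤ → ℝ, IsOverlapExpansion d ψ τ) ∧
    -- the construction yields the Zak-Gross kernel
    (∀ (ψ : Ket) (τ : ℤ × ℤ → ℝ), IsReference d ψ τ →
      (∀ ν : ℤ × ℤ, 0 < τ ν ∧
        τ ν = ‖codeInner d ψ (dispKet (ν.2 * step d) (ν.1 * step d) ψ)‖ ^ 2) ∧
      (∀ (ν : ℤ × ℤ) (f g : 𝓢(ℝ, ℂ)),
        MeasureTheory.Integrable (tensorIntegrand d ψ ν f g) (torusMeasure d) ∧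
        tensorOpAdj d ψ τ (logicalPhase d ψ) ν f g =
          ((√(2 * Real.pi))⁻¹ : ℂ) * zakGrossTerm d f g ν) ∧
      (∀ Ω ∈ torus d, ∀ f g : 𝓢(ℝ, ℂ),
        Summable (fun ν : ℤ × ℤ =>
          torusHarmonic d ν Ω * tensorOpAdj d ψ τ (logicalPhase d ψ) ν f g) ∧
        constructedKernel d ψ τ (logicalPhase d ψ) Ω f g = zakGrossKernel d Ω f g ∧
        -- the other phase choice yields the kernel without the signs
        constructedKernel d ψ τ (displacementPhase d ψ) Ω f g =
          1 / (2 * Real.pi) * ∑' ν : ℤ × ℤ,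
            Complex.exp (Complex.I * step d * (ν.2 * Ω.2 - ν.1 * Ω.1)) *
              braket f (displacement (ν.2 * step d) (ν.1 * step d) g))) ∧
    -- the result does not depend on the reference state
    (∀ (ψ ψ' : Ket) (τ τ' : ℤ × ℤ → ℝ), IsReference d ψ τ → IsReference d ψ' τ' →
      ∀ Ω ∈ torus d, ∀ f g : 𝓢(ℝ, ℂ),
        constructedKernel d ψ τ (logicalPhase d ψ) Ω f g =
          constructedKernel d ψ' τ' (logicalPhase d ψ') Ω f g) := by
  have : NeZero d := ⟨hd.pos.ne'⟩
  refine ⟨isInvariantMeasure, isHarmonicBasis, summable_zakGrossTerm hd.pos,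
    fun ψ hψ hiso => ⟨bijective_torusToPhaseSpace hiso,
      existsUnique_isOverlapExpansion hψ (ne_zero_of_isotropy_eq hiso)⟩,
    fun ψ τ h => ⟨fun ν => ⟨h.coeff_pos ν, h.coeff_eq ν⟩,
      fun ν f g => ⟨h.integrable_tensorIntegrand ν f g, h.tensorOpAdj_logicalPhase hd ν f g⟩,
      fun Ω _ f g => ⟨h.summable_kernel hd Ω f g, h.constructedKernel_logicalPhase hd Ω f g,
        h.constructedKernel_displacementPhase Ω f g⟩⟩,
    fun ψ ψ' τ τ' h h' Ω _ f g => ?_⟩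
  rw [h.constructedKernel_logicalPhase hd, h'.constructedKernel_logicalPhase hd]
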